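/- **Notation.** Let $R\ge 2$ and $N_{R^{-1}}(\mathcal P)=\{(t,t^2+\eta): |t|\le 1,\ |\eta|\le R^{-1}\}\subset\mathbb R^2$. Fourier transforms are normalized by $\hat g(\xi)=\int g(x)e^{-ix\cdot\xi}\,dx$ and taken in the sense of tempered distributions; all functions $f, f_\theta$ below are measurable functions $g:\mathbb R^2\to\mathbb C$ with $\int |g(x)|(1+|x|)^{-N}dx<\infty$ for some $N$. *Blocks.* For $0<s\le 1$ and $c\in\mathbb R$ let $\tau_{s,c}$ be the image of $[-1,1]\times[-2,2]$ under $(u,v)\mapsto (c,c^2)+(su,\,2csu+s^2v)$. The blocks of scale $s$ are the $\tau_{s,c}$ with $c=sm$, $m\in\mathbb Z$, $|m|\le\lceil s^{-1}\rceil$; they cover $N_{s^2}(\mathcal P)$ with bounded overlap. The blocks of scale $R^{-1/2}$ are denoted by $\theta$. *Tubes.* For a block $\tau=\tau_{s,c}$ let $$L_\tau=\begin{pmatrix}s^{-1}&-2cs^{-2}\\0&s^{-2}\end{pmatrix},\qquad q=[-\tfrac12,\tfrac12]^2,$$ $$\mathbb T_\tau=\{L_\tau(z+q):z\in\mathbb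 Z^2\},\qquad \mathbb U_\tau=\{Rs^2\cdot T:T\in\mathbb T_\tau\}.$$ Let $\mathbb U$ be the (disjoint) union of the families $\mathbb U_\tau$ over all blocks $\tau$ of all dyadic scales $s=2^{-j}$, $j\in\mathbb{N}_0$, $R^{-1/2}\le s\le 1$; write $\tau(U)=\tau$ for $U\in\mathbb U_\tau$. *Weight parameters.* For measurable $H:\mathbb R^2\to[0,1]$ write $H(E)=\int_E H\,dx$, and for $U\in\mathbb U$ and $2\le p\le 4$ put $$\kappa_{p,H}(U)=\max_{T\in\mathbb T_{\tau(U)}}\Big(\frac{H(T\cap U)}{|T|}\Big)^{\frac14}\Big(\frac{H(U)}{|U|}\Big)^{\frac1p-\frac14}.$$ **Theorem.** There is an absolute constant $A$ and, for every $2\le p\le 4$, a constant $C_p$ depending only on $p$ such that the following holds for all $R\ge 2$ and all measurable $H:\mathbb R^2\to[0,1]$. Let $\hat f$ be supported in $N_{R^{-1}}(\mathcal P)$, and let $f=\sum_\theta f_\theta$ almost everywhere, where $\theta$ runs over the blocks of scale $R^{-1/2}$ and each $\hat f_\theta$ is supported in $\theta$. Then $$\|f\|_{L^p(H\,dx)}\le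 C_p(\log R)^{A}\Big(\sup_{U\in\mathbb U}\kappa_{p,H}(U)+R^{-100}\Big)\Big\|\Big(\sum_\theta|f_\theta|^2\Big)^{1/2}\Big\|_{L^p(\mathbb R^2)}.$$ -/

import Mathlib

open MeasureTheory
open scoped SchwartzMap FourierTransform Pointwise ENNReal

noncomputable section

namespace WeightedSquare

/-- The Euclidean plane. -/
abbrev Plane : Type := EuclideanSpace ℝ (Fin 2)

/-- The vertical `r`-neighbourhood `{(t, t² + η) : |t| ≤ 1, |η| ≤ r}` of the truncated parabola. -/
def parabolaNhd (r : ℝ) : Set Plane :=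
  {ξ | |ξ 0| ≤ 1 ∧ |ξ 1 - ξ 0 ^ 2| ≤ r}

/-- The canonical block of dimensions `s × s²` centred at `(c, c²)`: the image of
`[-1,1] × [-2,2]` under `(u, v) ↦ (c, c²) + (s u, 2 c s u + s² v)`. -/
def block (s c : ℝ) : Set Plane :=
  {ξ | ∃ u v : ℝ, |u| ≤ 1 ∧ |v| ≤ 2 ∧
    ξ 0 = c + s * u ∧ ξ 1 = c ^ 2 + (2 * c * s * u + s ^ 2 * v)}

/-- The blocks of scale `s` are centred over the points `c = s m`, `m ∈ blockIndices s`. -/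
def blockIndices (s : ℝ) : Finset ℤ := Finset.Icc (-⌈s⁻¹⌉) ⌈s⁻¹⌉

/-- The linear map of the parabolic rescaling attached to the block of scale `s` and centre
`(c, c²)`. -/
def rescaling (s c : ℝ) : Plane →ₗ[ℝ] Plane :=
  Matrix.toLpLin 2 2 !![s⁻¹, -2 * c * (s ^ 2)⁻¹; 0, (s ^ 2)⁻¹]

/-- The closed unit square centred at the lattice point `z`. -/
def unitSquare (z : Fin 2 → ℤ) : Set Plane :=
  {x | ∀ i, |x i - z i| ≤ 1 / 2}

/-- The tiling of the plane by translates of the parallelogram dual to a block. -/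
def tubes (s c : ℝ) : Set (Set Plane) :=
  Set.range fun z : Fin 2 → ℤ => rescaling s c '' unitSquare z

/-- The tiling of the plane by the `R s²`-dilates of the tubes. -/
def envelopes (R s c : ℝ) : Set (Set Plane) :=
  {U | ∃ T ∈ tubes s c, U = (R * s ^ 2) • T}

/-- The dyadic scales `s` with `R^{-1/2} ≤ s ≤ 1`. -/
def scales (R : ℝ) : Set ℝ :=
  {s | (∃ j : ℕ, s = (1 / 2 : ℝ) ^ j) ∧ (√R)⁻¹ ≤ s}

/-- `κ_{p,H}(U)` for an envelope `U` attached to the block of scale `s` and centre `(c, c²)`.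
Tubes lying in `U` contribute the mean of `H` over the tube. A tube crossing the boundary of `U`
contributes through its part in `U`, so that all of `U` is seen also when the tubes contained in
`U` do not cover `U`. -/
def kappa (p : ℝ) (H : Plane → ℝ) (s c : ℝ) (U : Set Plane) : ℝ :=
  ⨆ T : tubes s c,
    ((∫ x in (T : Set Plane) ∩ U, H x) / volume.real (T : Set Plane)) ^ (1 / 4 : ℝ) *
      ((∫ x in U, H x) / volume.real U) ^ (1 / p - 1 / 4)

/-- The supremum of `κ_{p,H}(U)` over all envelopes of all blocks of all dyadic scales. -/
def kappaSup (p : ℝ) (H : Plane → ℝ) (R : ℝ) : ℝ :=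
  sSup {k | ∃ s ∈ scales R, ∃ m ∈ blockIndices s, ∃ U ∈ envelopes R s (s * m),
    k = kappa p H s (s * m) U}

/-- A (measurable) function of at most polynomial growth in the mean, so that it defines a
tempered distribution. -/
def IsTempered (g : Plane → ℂ) : Prop :=
  ∃ N : ℕ, Integrable fun x => (((1 + ‖x‖) ^ N)⁻¹ : ℝ) • g x

/-- The distributional Fourier transform of `g`, in the normalization
`ĝ(ξ) = ∫ g(x) exp(-i x·ξ) dx`: it sends `φ` to `∫ g φ̂`, and `φ̂(x) = 𝓕 φ (x / 2π)`. -/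
def fourierDistribution (g : Plane → ℂ) (φ : 𝓢(Plane, ℂ)) : ℂ :=
  ∫ x, g x * 𝓕 φ ((2 * Real.pi)⁻¹ • x)

/-- `g` is a tempered function whose Fourier transform is supported in the closed set `K`. -/
def HasFourierSupportIn (g : Plane → ℂ) (K : Set Plane) : Prop :=
  IsTempered g ∧ Distribution.IsVanishingOn (fourierDistribution g) Kᶜ

/-- `f = ∑_θ f_θ`, where `θ` runs over the blocks of scale `R^{-1/2}` and the Fourier transform of
`f_θ` is supported in `θ`. -/
def IsBlockDecomposition (R : ℝ) (f : Plane → ℂ) (fθ : ℤ → Plane → ℂ) : Prop :=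
  (∀ m ∈ blockIndices (√R)⁻¹, HasFourierSupportIn (fθ m) (block (√R)⁻¹ ((√R)⁻¹ * m))) ∧
    ∀ᵐ x, f x = ∑ m ∈ blockIndices (√R)⁻¹, fθ m x

/-- The square function `(∑_θ |f_θ|²)^{1/2}`. -/
def squareFunction (R : ℝ) (fθ : ℤ → Plane → ℂ) (x : Plane) : ℝ :=
  √(∑ m ∈ blockIndices (√R)⁻¹, ‖fθ m x‖ ^ 2)

end WeightedSquare

end

/-!
A broad-narrow argument over dyadic scales bounds `|∑_θ f_θ|`, up to a factor `log R`, by geometric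
means of pairs of partial sums over dyadic intervals of blocks. The two intervals of a pair are
separated by about their length `s`, except at the finest scale, and lie in a common block of
scale `s`. The parabolic rescaling attached to that block turns such a pair into a transverse one,
for which Córdoba's `L²` bilinear estimate holds on squares of side `R s²`; these squares are the
envelopes in the rescaled coordinates. Conversely, functions with Fourier support in a bounded set
see a weight only through its masses on unit squares, which in the rescaled coordinates are the
averages of `H` over tubes. Interpolating by Hölder between the weighted `L⁴` bound and the mass of
`H` on an envelope produces `κ_{p,H}`, and the sum over pairs at a fixed scale costs `O(1)`.
-/

namespace WeightedSquare

section CauchySchwarz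

variable {α : Type*} [MeasurableSpace α] {μ : Measure α} {f g : α → ℝ≥0∞}

lemma sq_lintegral_mul_le (hf : AEMeasurable f μ) (hg : AEMeasurable g μ) :
    (∫⁻ x, f x * g x ∂μ) ^ 2 ≤ (∫⁻ x, f x ^ 2 ∂μ) * ∫⁻ x, g x ^ 2 ∂μ := by
  have hroot (a : ℝ≥0∞) : (a ^ 2) ^ (1 / 2 : ℝ) = a := by
    simp [← ENNReal.rpow_natCast_mul]
  have hsq (a : ℝ≥0∞) : (a ^ (1 / 2 : ℝ)) ^ 2 = a := by
    simp [← ENNReal.rpow_mul_natCast]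
  have h := ENNReal.lintegral_mul_norm_pow_le (hf.pow_const 2) (hg.pow_const 2)
    (p := 1 / 2) (q := 1 / 2) (by norm_num) (by norm_num) (by norm_num)
  simp only [hroot] at h
  calc (∫⁻ x, f x * g x ∂μ) ^ 2
      ≤ ((∫⁻ x, f x ^ 2 ∂μ) ^ (1 / 2 : ℝ) * (∫⁻ x, g x ^ 2 ∂μ) ^ (1 / 2 : ℝ)) ^ 2 := by gcongr
    _ = _ := by rw [mul_pow, hsq, hsq]

lemma sq_lintegral_mul_le_lintegral_sq_mul (hf : AEMeasurable f μ) (hg : AEMeasurable g μ) :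
    (∫⁻ x, f x * g x ∂μ) ^ 2 ≤ (∫⁻ x, f x ^ 2 * g x ∂μ) * ∫⁻ x, g x ∂μ := by
  have hsq (a : ℝ≥0∞) : (a ^ (1 / 2 : ℝ)) ^ 2 = a := by
    simp [← ENNReal.rpow_mul_natCast]
  have h := sq_lintegral_mul_le (hf.mul (hg.pow_const (1 / 2 : ℝ))) (hg.pow_const (1 / 2 : ℝ))
  simpa only [Pi.mul_apply, mul_pow, hsq, mul_assoc, ← sq] using h

lemma sq_setLIntegral_le (hf : AEMeasurable f μ) (s : Set α) :
    (∫⁻ x in s, f x ∂μ) ^ 2 ≤ μ s * ∫⁻ x in s, f x ^ 2 ∂μ := by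
  simpa [mul_comm] using
    sq_lintegral_mul_le hf.restrict (aemeasurable_const (b := (1 : ℝ≥0∞)) (μ := μ.restrict s))

lemma enorm_integral_sq_le_measure_support_mul {E : Type*} [NormedAddCommGroup E]
    [NormedSpace ℝ E] {φ : α → E} (hφ : AEStronglyMeasurable φ μ) :
    ‖∫ x, φ x ∂μ‖ₑ ^ 2 ≤ μ (Function.support φ) * ∫⁻ x, ‖φ x‖ₑ ^ 2 ∂μ :=
  calc ‖∫ x, φ x ∂μ‖ₑ ^ 2 = ‖∫ x in Function.support φ, φ x ∂μ‖ₑ ^ 2 := by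
        rw [setIntegral_support]
    _ ≤ (∫⁻ x in Function.support φ, ‖φ x‖ₑ ∂μ) ^ 2 := by
        gcongr; exact enorm_integral_le_lintegral_enorm _
    _ ≤ μ (Function.support φ) * ∫⁻ x in Function.support φ, ‖φ x‖ₑ ^ 2 ∂μ :=
        sq_setLIntegral_le hφ.enorm _
    _ ≤ _ := by exact mul_le_mul_right (setLIntegral_le_lintegral _ _) _

end CauchySchwarz

lemma lintegral_enorm_sq_eq_ofReal_integral_of_ae_bdd {α E : Type*} [MeasurableSpace α]
    [NormedAddCommGroup E] {μ : Measure α} {f : α → E} (hf : Integrable f μ) {B : ℝ}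
    (hB : ∀ᵐ x ∂μ, ‖f x‖ ≤ B) :
    ∫⁻ x, ‖f x‖ₑ ^ 2 ∂μ = ENNReal.ofReal (∫ x, ‖f x‖ ^ 2 ∂μ) := by
  have hsq : Integrable (fun x => ‖f x‖ ^ 2) μ := by
    simpa only [sq] using hf.norm.bdd_mul hf.norm.1 (hB.mono fun x hx => by rwa [norm_norm])
  rw [ofReal_integral_eq_lintegral_ofReal hsq (.of_forall fun x => sq_nonneg _)]
  simp only [ENNReal.ofReal_pow (norm_nonneg _), ofReal_norm]

section Fourier

variable {V : Type*} [NormedAddCommGroup V] [InnerProductSpace ℝ V] [FiniteDimensional ℝ V]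
  [MeasurableSpace V] [BorelSpace V] {E : Type*} [NormedAddCommGroup E] [NormedSpace ℂ E]

lemma continuous_fourier {f : V → E} (hf : Integrable f) : Continuous (𝓕 f) :=
  VectorFourier.fourierIntegral_continuous Real.continuous_fourierChar
    (L := innerₗ V) continuous_inner hf

lemma continuous_fourierInv {f : V → E} (hf : Integrable f) : Continuous (𝓕⁻ f) := by
  rw [Real.fourierInv_eq_fourier_comp_neg]
  exact continuous_fourier hf.comp_neg

lemma norm_fourier_le (f : V → E) (ξ : V) : ‖𝓕 f ξ‖ ≤ ∫ x, ‖f x‖ :=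
  VectorFourier.norm_fourierIntegral_le_integral_norm _ _ _ _ _

lemma norm_fourierInv_le (f : V → E) (x : V) : ‖𝓕⁻ f x‖ ≤ ∫ ξ, ‖f ξ‖ := by
  rw [Real.fourierInv_eq_fourier_neg]
  exact norm_fourier_le f _

lemma fourier_fun_finset_sum {ι : Type*} (s : Finset ι) {g : ι → V → E}
    (hg : ∀ i ∈ s, Integrable (g i)) (ξ : V) :
    𝓕 (fun x => ∑ i ∈ s, g i x) ξ = ∑ i ∈ s, 𝓕 (g i) ξ := by
  simp_rw [Real.fourier_eq, Finset.smul_sum]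
  exact integral_finsetSum _ fun i hi => by simpa using hg i hi

lemma integrable_fourier_of_support_subset_closedBall {f : V → E} (hf : Integrable f) {r : ℝ}
    (h : Function.support (𝓕 f) ⊆ Metric.closedBall 0 r) : Integrable (𝓕 f) :=
  (continuous_fourier hf).integrable_of_hasCompactSupport <|
    HasCompactSupport.intro (isCompact_closedBall 0 r) fun _ hx =>
      Function.notMem_support.1 (mt (@h _) hx)

lemma integral_fourier_smul_eq_flip [CompleteSpace E] {f : V → ℂ} {g : V → E}
    (hf : Integrable f) (hg : Integrable g) : ∫ ξ, 𝓕 f ξ • g ξ = ∫ x, f x • 𝓕 g x := by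
  have h := VectorFourier.integral_fourierIntegral_smul_eq_flip (L := innerₗ V)
    (μ := volume) (ν := volume) Real.continuous_fourierChar continuous_inner hf hg
  rwa [flip_innerₗ] at h

lemma integral_fourierInv_smul_eq_flip [CompleteSpace E] {f : V → ℂ} {g : V → E}
    (hf : Integrable f) (hg : Integrable g) : ∫ ξ, 𝓕⁻ f ξ • g ξ = ∫ x, f x • 𝓕⁻ g x := by
  rw [Real.fourierInv_eq_fourier_comp_neg, integral_fourier_smul_eq_flip hf.comp_neg hg,
    ← integral_neg_eq_self]
  simp only [neg_neg, Real.fourierInv_eq_fourier_neg]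

lemma ae_eq_fourierInv_fourier [CompleteSpace E] {f : V → E} (hf : Integrable f)
    (hF : Integrable (𝓕 f)) : f =ᵐ[volume] 𝓕⁻ (𝓕 f) := by
  refine ae_eq_of_integral_contDiff_smul_eq hf.locallyIntegrable
    (continuous_fourierInv hF).locallyIntegrable fun g hg hgc => ?_
  have hc : HasCompactSupport fun x => (g x : ℂ) := hgc.comp_left Complex.ofReal_zero
  let φ : 𝓢(V, ℂ) := hc.toSchwartzMap (Complex.ofRealCLM.contDiff.comp hg)
  have hφ : 𝓕 (𝓕⁻ (φ : V → ℂ)) = φ := by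
    rw [← SchwartzMap.fourierInv_coe, ← SchwartzMap.fourier_coe,
      FourierTransform.fourier_fourierInv_eq]
  have hφi : Integrable (𝓕⁻ (φ : V → ℂ)) := by
    rw [← SchwartzMap.fourierInv_coe]
    exact (𝓕⁻ φ).integrable
  calc ∫ x, g x • f x = ∫ x, 𝓕 (𝓕⁻ (φ : V → ℂ)) x • f x := by rw [hφ]; rfl
    _ = ∫ ξ, 𝓕⁻ (φ : V → ℂ) ξ • 𝓕 f ξ := integral_fourier_smul_eq_flip hφi hf
    _ = ∫ x, φ x • 𝓕⁻ (𝓕 f) x := integral_fourierInv_smul_eq_flip φ.integrable hF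
    _ = _ := rfl

lemma ae_norm_le_integral_norm_fourier [CompleteSpace E] {f : V → E} (hf : Integrable f)
    (hF : Integrable (𝓕 f)) : ∀ᵐ x, ‖f x‖ ≤ ∫ ξ, ‖𝓕 f ξ‖ := by
  filter_upwards [ae_eq_fourierInv_fourier hf hF] with x hx
  rw [hx]
  exact norm_fourierInv_le _ _

lemma lintegral_enorm_sq_fourier {H : Type*} [NormedAddCommGroup H] [InnerProductSpace ℂ H]
    [CompleteSpace H] {f : V → H} (hf : Integrable f) (hF : Integrable (𝓕 f)) :
    ∫⁻ ξ, ‖𝓕 f ξ‖ₑ ^ 2 = ∫⁻ x, ‖f x‖ₑ ^ 2 := by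
  have hflip := VectorFourier.integral_sesq_fourierIntegral_eq_neg_flip (innerSL ℂ)
    (L := innerₗ V) (μ := volume) (ν := volume) Real.continuous_fourierChar continuous_inner
    hf hF
  have hinner : ∫ ξ, inner ℂ (𝓕 f ξ) (𝓕 f ξ) = ∫ x, inner ℂ (f x) (f x) := by
    rw [flip_innerₗ] at hflip
    refine hflip.trans (integral_congr_ae ?_)
    filter_upwards [ae_eq_fourierInv_fourier hf hF] with x hx
    exact congrArg (inner ℂ (f x)) hx.symm
  rw [lintegral_enorm_sq_eq_ofReal_integral_of_ae_bdd hF (.of_forall (norm_fourier_le f)),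
    lintegral_enorm_sq_eq_ofReal_integral_of_ae_bdd hf (ae_norm_le_integral_norm_fourier hf hF)]
  congr 1
  simp only [inner_self_eq_norm_sq_to_K, ← Complex.ofReal_pow, RCLike.ofReal_eq_complex_ofReal,
    integral_complex_ofReal] at hinner
  exact_mod_cast hinner

end Fourier

section Bilinear

variable {V : Type*} [NormedAddCommGroup V] [InnerProductSpace ℝ V] [FiniteDimensional ℝ V]
  [MeasurableSpace V] [BorelSpace V] {f g : V → ℂ}

lemma integrable_mul_of_integrable_fourier (hf : Integrable f) (hF : Integrable (𝓕 f))
    (hg : Integrable g) : Integrable (fun x => f x * g x) :=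
  hg.bdd_mul hf.1 (ae_norm_le_integral_norm_fourier hf hF)

lemma fourier_mul_eq_integral (hf : Integrable f) (hF : Integrable (𝓕 f)) (hg : Integrable g)
    (ξ : V) : 𝓕 (fun x => f x * g x) ξ = ∫ ζ, 𝓕 f ζ * 𝓕 g (ξ - ζ) := by
  have hmod : Integrable fun x => Real.fourierChar (-inner ℝ x ξ) • g x := by simpa using hg
  have hshift (ζ : V) :
      𝓕⁻ (fun x => Real.fourierChar (-inner ℝ x ξ) • g x) ζ = 𝓕 g (ξ - ζ) := by
    simp only [Real.fourierInv_eq, Real.fourier_eq, smul_smul, ← AddChar.map_add_eq_mul,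
      inner_sub_right, neg_sub, ← sub_eq_add_neg]
  calc 𝓕 (fun x => f x * g x) ξ
      = ∫ x, 𝓕⁻ (𝓕 f) x • Real.fourierChar (-inner ℝ x ξ) • g x := by
        rw [Real.fourier_eq]
        refine integral_congr_ae ?_
        filter_upwards [ae_eq_fourierInv_fourier hf hF] with x hx
        rw [← hx, smul_comm, smul_eq_mul]
    _ = _ := by
        rw [integral_fourierInv_smul_eq_flip hF hmod]
        simp only [hshift, smul_eq_mul]

lemma integrable_fourier_mul (hf : Integrable f) (hF : Integrable (𝓕 f)) (hg : Integrable g)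
    (hG : Integrable (𝓕 g)) : Integrable (𝓕 fun x => f x * g x) :=
  (hF.integrable_convolution (ContinuousLinearMap.mul ℂ ℂ) hG).congr
    (.of_forall fun ξ => (fourier_mul_eq_integral hf hF hg ξ).symm)

lemma support_fourier_mul_subset_closedBall (hf : Integrable f) (hg : Integrable g) {r ρ : ℝ}
    (hr : Function.support (𝓕 f) ⊆ Metric.closedBall 0 r)
    (hρ : Function.support (𝓕 g) ⊆ Metric.closedBall 0 ρ) :
    Function.support (𝓕 fun x => f x * g x) ⊆ Metric.closedBall 0 (r + ρ) := by
  intro ξ hξ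
  rw [Function.mem_support,
    fourier_mul_eq_integral hf (integrable_fourier_of_support_subset_closedBall hf hr) hg] at hξ
  obtain ⟨ζ, hζ⟩ : ∃ ζ, 𝓕 f ζ * 𝓕 g (ξ - ζ) ≠ 0 := by
    by_contra! h
    simp [h] at hξ
  have hζr := mem_closedBall_zero_iff.1 (hr (left_ne_zero_of_mul hζ))
  have hζρ := mem_closedBall_zero_iff.1 (hρ (right_ne_zero_of_mul hζ))
  rw [mem_closedBall_zero_iff]
  linarith [norm_sub_norm_le ξ ζ]

lemma lintegral_lintegral_mul_sub {u v : V → ℝ≥0∞} (hu : Measurable u) (hv : Measurable v) :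
    ∫⁻ ξ, ∫⁻ ζ, u ζ * v (ξ - ζ) = (∫⁻ ζ, u ζ) * ∫⁻ ζ, v ζ := by
  have hmeas : Measurable fun q : V × V => u q.2 * v (q.1 - q.2) := by fun_prop
  rw [lintegral_lintegral_swap hmeas.aemeasurable, ← lintegral_mul_const _ hu]
  refine lintegral_congr fun ζ => ?_
  rw [lintegral_const_mul _ (by fun_prop), lintegral_sub_right_eq_self v]

/-- Córdoba's argument: on the Fourier side the product is a convolution, to which
Cauchy–Schwarz is applied on the fibre `{ζ | 𝓕 f ζ ≠ 0 ∧ 𝓕 g (ξ - ζ) ≠ 0}`. -/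
lemma lintegral_enorm_sq_mul_le (hf : Integrable f) (hF : Integrable (𝓕 f))
    (hg : Integrable g) (hG : Integrable (𝓕 g)) {δ : ℝ≥0∞}
    (hδ : ∀ ξ, volume {ζ | 𝓕 f ζ ≠ 0 ∧ 𝓕 g (ξ - ζ) ≠ 0} ≤ δ) :
    ∫⁻ x, ‖f x * g x‖ₑ ^ 2 ≤ δ * ((∫⁻ x, ‖f x‖ₑ ^ 2) * ∫⁻ x, ‖g x‖ₑ ^ 2) := by
  have cF := continuous_fourier hf
  have cG := continuous_fourier hg
  have hfibre (ξ : V) : ‖𝓕 (fun x => f x * g x) ξ‖ₑ ^ 2 ≤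
      δ * ∫⁻ ζ, ‖𝓕 f ζ‖ₑ ^ 2 * ‖𝓕 g (ξ - ζ)‖ₑ ^ 2 := by
    have hcont : Continuous fun ζ => 𝓕 f ζ * 𝓕 g (ξ - ζ) := by fun_prop
    rw [fourier_mul_eq_integral hf hF hg]
    refine (enorm_integral_sq_le_measure_support_mul hcont.aestronglyMeasurable).trans ?_
    simp only [enorm_mul, mul_pow]
    gcongr
    simpa only [Function.support, mul_ne_zero_iff] using hδ ξ
  rw [← lintegral_enorm_sq_fourier (integrable_mul_of_integrable_fourier hf hF hg)
    (integrable_fourier_mul hf hF hg hG), ← lintegral_enorm_sq_fourier hf hF,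
    ← lintegral_enorm_sq_fourier hg hG]
  have hF2 : Measurable fun ζ => ‖𝓕 f ζ‖ₑ ^ 2 := cF.enorm.measurable.pow_const 2
  have hG2 : Measurable fun ζ => ‖𝓕 g ζ‖ₑ ^ 2 := cG.enorm.measurable.pow_const 2
  calc ∫⁻ ξ, ‖𝓕 (fun x => f x * g x) ξ‖ₑ ^ 2
      ≤ ∫⁻ ξ, δ * ∫⁻ ζ, ‖𝓕 f ζ‖ₑ ^ 2 * ‖𝓕 g (ξ - ζ)‖ₑ ^ 2 := lintegral_mono hfibre
    _ = δ * ∫⁻ ξ, ∫⁻ ζ, ‖𝓕 f ζ‖ₑ ^ 2 * ‖𝓕 g (ξ - ζ)‖ₑ ^ 2 :=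
        lintegral_const_mul _ (Measurable.lintegral_prod_right' (f := fun q : V × V =>
          ‖𝓕 f q.2‖ₑ ^ 2 * ‖𝓕 g (q.1 - q.2)‖ₑ ^ 2) (by fun_prop))
    _ = _ := by rw [lintegral_lintegral_mul_sub hF2 hG2]

lemma ae_eq_convolution (hf : Integrable f) (hF : Integrable (𝓕 f)) (K : 𝓢(V, ℂ))
    (hK : ∀ ζ, 𝓕 f ζ ≠ 0 → 𝓕 (K : V → ℂ) ζ = 1) :
    ∀ᵐ x, f x = ∫ v, f v * K (x - v) := by
  have hconv := hf.integrable_convolution (ContinuousLinearMap.mul ℂ ℂ)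
    (K.integrable (μ := volume))
  have hfourier : 𝓕 (convolution f K (ContinuousLinearMap.mul ℂ ℂ) volume) = 𝓕 f := by
    ext ζ
    rw [Real.fourier_mul_convolution_eq hf K.integrable]
    by_cases h : 𝓕 f ζ = 0
    · rw [h, zero_mul]
    · rw [hK ζ h, mul_one]
  have hinv := ae_eq_fourierInv_fourier hconv (hfourier ▸ hF)
  rw [hfourier] at hinv
  filter_upwards [ae_eq_fourierInv_fourier hf hF, hinv] with x hx hx'
  rw [hx, ← hx']
  rfl

lemma exists_schwartz_fourier_eq_one_on_closedBall (r : ℝ) :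
    ∃ K : 𝓢(V, ℂ), ∀ ζ ∈ Metric.closedBall (0 : V) r, 𝓕 (K : V → ℂ) ζ = 1 := by
  let b : ContDiffBump (0 : V) := ⟨max r 1, max r 1 + 1, by positivity, by linarith⟩
  have hc : HasCompactSupport fun x => (b x : ℂ) :=
    b.hasCompactSupport.comp_left Complex.ofReal_zero
  refine ⟨𝓕⁻ (hc.toSchwartzMap (Complex.ofRealCLM.contDiff.comp b.contDiff)), fun ζ hζ => ?_⟩
  rw [← SchwartzMap.fourier_coe, FourierTransform.fourier_fourierInv_eq]
  change (b ζ : ℂ) = 1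
  rw [b.one_of_mem_closedBall (Metric.closedBall_subset_closedBall (le_max_left _ _) hζ),
    Complex.ofReal_one]

end Bilinear

section BoundedOverlap

variable {V : Type*} [NormedAddCommGroup V] [InnerProductSpace ℝ V] [FiniteDimensional ℝ V]
  [MeasurableSpace V] [BorelSpace V] {ι : Type*}

/-- A finite family of integrable functions whose Fourier transforms are supported in the ball of
radius `r` about the origin, at most `N` of them being nonzero at any given frequency. -/
structure BoundedOverlap (r : ℝ) (N : ℕ) (s : Finset ι) (g : ι → V → ℂ) : Prop where
  integrable : ∀ i ∈ s, Integrable (g i)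
  support_subset : ∀ i ∈ s, Function.support (𝓕 (g i)) ⊆ Metric.closedBall 0 r
  card_le : ∀ ζ, (s.filter fun i => 𝓕 (g i) ζ ≠ 0).card ≤ N

namespace BoundedOverlap

variable {r : ℝ} {N : ℕ} {s : Finset ι} {g : ι → V → ℂ}

lemma integrable_sum (h : BoundedOverlap r N s g) : Integrable fun x => ∑ i ∈ s, g i x :=
  integrable_finsetSum s h.integrable

lemma exists_fourier_ne_zero (h : BoundedOverlap r N s g) {ζ : V}
    (hζ : 𝓕 (fun x => ∑ i ∈ s, g i x) ζ ≠ 0) : ∃ i ∈ s, 𝓕 (g i) ζ ≠ 0 := by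
  rw [fourier_fun_finset_sum s h.integrable] at hζ
  exact Finset.exists_ne_zero_of_sum_ne_zero hζ

lemma support_fourier_sum_subset (h : BoundedOverlap r N s g) :
    Function.support (𝓕 fun x => ∑ i ∈ s, g i x) ⊆ Metric.closedBall 0 r := fun _ hζ =>
  let ⟨i, hi, hiζ⟩ := h.exists_fourier_ne_zero hζ
  h.support_subset i hi hiζ

lemma integrable_fourier (h : BoundedOverlap r N s g) {i : ι} (hi : i ∈ s) :
    Integrable (𝓕 (g i)) :=
  integrable_fourier_of_support_subset_closedBall (h.integrable i hi) (h.support_subset i hi)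

lemma integrable_fourier_sum (h : BoundedOverlap r N s g) :
    Integrable (𝓕 fun x => ∑ i ∈ s, g i x) :=
  integrable_fourier_of_support_subset_closedBall h.integrable_sum h.support_fourier_sum_subset

lemma enorm_sq_fourier_sum_le (h : BoundedOverlap r N s g) (ζ : V) :
    ‖𝓕 (fun x => ∑ i ∈ s, g i x) ζ‖ₑ ^ 2 ≤ N * ∑ i ∈ s, ‖𝓕 (g i) ζ‖ₑ ^ 2 := by
  let t := s.filter fun i => 𝓕 (g i) ζ ≠ 0
  have hreal : ‖∑ i ∈ s, 𝓕 (g i) ζ‖ ^ 2 ≤ N * ∑ i ∈ s, ‖𝓕 (g i) ζ‖ ^ 2 :=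
    calc ‖∑ i ∈ s, 𝓕 (g i) ζ‖ ^ 2 = ‖∑ i ∈ t, 𝓕 (g i) ζ‖ ^ 2 := by
          rw [Finset.sum_filter_ne_zero]
      _ ≤ (∑ i ∈ t, ‖𝓕 (g i) ζ‖) ^ 2 := by gcongr; exact norm_sum_le _ _
      _ ≤ t.card * ∑ i ∈ t, ‖𝓕 (g i) ζ‖ ^ 2 := sq_sum_le_card_mul_sum_sq
      _ ≤ N * ∑ i ∈ s, ‖𝓕 (g i) ζ‖ ^ 2 := by
          gcongr
          · exact h.card_le ζ
          · exact Finset.filter_subset _ _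
  rw [fourier_fun_finset_sum s h.integrable]
  have hofReal := ENNReal.ofReal_le_ofReal hreal
  rw [ENNReal.ofReal_mul (by positivity), ENNReal.ofReal_sum_of_nonneg (by intros; positivity),
    ENNReal.ofReal_natCast] at hofReal
  simpa only [ENNReal.ofReal_pow (norm_nonneg _), ofReal_norm] using hofReal

lemma lintegral_enorm_sq_sum_le (h : BoundedOverlap r N s g) :
    ∫⁻ x, ‖∑ i ∈ s, g i x‖ₑ ^ 2 ≤ N * ∑ i ∈ s, ∫⁻ x, ‖g i x‖ₑ ^ 2 := by
  rw [← lintegral_enorm_sq_fourier h.integrable_sum h.integrable_fourier_sum]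
  calc _ ≤ ∫⁻ ζ, N * ∑ i ∈ s, ‖𝓕 (g i) ζ‖ₑ ^ 2 := lintegral_mono h.enorm_sq_fourier_sum_le
    _ = N * ∑ i ∈ s, ∫⁻ ζ, ‖𝓕 (g i) ζ‖ₑ ^ 2 := by
        rw [lintegral_const_mul' _ _ (by simp), lintegral_finsetSum' s fun i hi =>
          ((continuous_fourier (h.integrable i hi)).enorm.measurable.pow_const 2).aemeasurable]
    _ = _ := by
        congr 1
        exact Finset.sum_congr rfl fun i hi =>
          lintegral_enorm_sq_fourier (h.integrable i hi) (h.integrable_fourier hi)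

end BoundedOverlap

end BoundedOverlap

section Decay

/-- The weight `(1 + |a|)⁻² (1 + |b|)⁻²`, which is summable over translates by the integer
lattice. -/
noncomputable def decay (a b : ℝ) : ℝ := ((1 + |a|) ^ 2 * (1 + |b|) ^ 2)⁻¹

lemma decay_nonneg (a b : ℝ) : 0 ≤ decay a b := by unfold decay; positivity

lemma decay_le_one (a b : ℝ) : decay a b ≤ 1 :=
  inv_le_one_of_one_le₀ <| one_le_mul_of_one_le_of_one_le
    (one_le_pow₀ (by linarith [abs_nonneg a])) (one_le_pow₀ (by linarith [abs_nonneg b]))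

lemma decay_sub_comm (a b a' b' : ℝ) : decay (a - a') (b - b') = decay (a' - a) (b' - b) := by
  simp only [decay, abs_sub_comm]

lemma decay_le_of_close {a b a' b' : ℝ} (ha : |a - a'| ≤ 1 / 2) (hb : |b - b'| ≤ 1 / 2) :
    decay a b ≤ 6 * decay a' b' := by
  have hclose {x y : ℝ} (h : |x - y| ≤ 1 / 2) : 1 + |y| ≤ 3 / 2 * (1 + |x|) := by
    have := abs_sub_abs_le_abs_sub y x
    rw [abs_sub_comm] at this
    linarith [abs_nonneg x]
  unfold decay
  rw [← div_eq_mul_inv, inv_eq_one_div, div_le_div_iff₀ (by positivity) (by positivity), one_mul]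
  calc (1 + |a'|) ^ 2 * (1 + |b'|) ^ 2
      ≤ (3 / 2 * (1 + |a|)) ^ 2 * (3 / 2 * (1 + |b|)) ^ 2 := by
        gcongr
        · exact hclose ha
        · exact hclose hb
    _ = 81 / 16 * ((1 + |a|) ^ 2 * (1 + |b|) ^ 2) := by ring
    _ ≤ _ := by gcongr; norm_num

lemma inv_sq_one_add_abs_sub_le {u : ℝ} (hu : u ∈ Set.Ico (0 : ℝ) 1) (m : ℤ) :
    ((1 + |u - m|) ^ 2)⁻¹ ≤ 1 / (m : ℝ) ^ 2 + if m = 0 then 1 else 0 := by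
  rcases eq_or_ne m 0 with rfl | hm
  · have : ((1 + |u|) ^ 2)⁻¹ ≤ 1 :=
      inv_le_one_of_one_le₀ (one_le_pow₀ (by linarith [abs_nonneg u]))
    simpa using this
  · have : 0 < |(m : ℝ)| := by positivity
    have hmu : |(m : ℝ)| ≤ 1 + |u - m| := by
      have h := abs_sub_abs_le_abs_sub (m : ℝ) u
      rw [abs_sub_comm, abs_of_nonneg hu.1] at h
      linarith [hu.2]
    rw [if_neg hm, add_zero, one_div, ← sq_abs (m : ℝ)]
    gcongr

lemma exists_tsum_int_decay_le :
    ∃ C : ℝ≥0∞, C ≠ ⊤ ∧ ∀ t : ℝ, ∑' n : ℤ, ENNReal.ofReal ((1 + |t - n|) ^ 2)⁻¹ ≤ C := by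
  have hs : Summable fun m : ℤ => 1 / (m : ℝ) ^ 2 + if m = 0 then (1 : ℝ) else 0 :=
    (Real.summable_one_div_int_pow.2 (by norm_num)).add (hasSum_ite_eq (0 : ℤ) (1 : ℝ)).summable
  refine ⟨_, hs.tsum_ofReal_ne_top, fun t => ?_⟩
  rw [← (Equiv.addRight ⌊t⌋).tsum_eq fun n : ℤ => ENNReal.ofReal ((1 + |t - n|) ^ 2)⁻¹]
  refine ENNReal.tsum_le_tsum fun m => ENNReal.ofReal_le_ofReal ?_
  have hfract : t - ((m + ⌊t⌋ : ℤ) : ℝ) = Int.fract t - m := by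
    push_cast [Int.fract]; ring
  rw [Equiv.coe_addRight, hfract]
  exact inv_sq_one_add_abs_sub_le ⟨Int.fract_nonneg t, Int.fract_lt_one t⟩ m

lemma exists_tsum_decay_le :
    ∃ C : ℝ≥0∞, C ≠ ⊤ ∧ ∀ a b : ℝ,
      ∑' z : Fin 2 → ℤ, ENNReal.ofReal (decay (a - z 0) (b - z 1)) ≤ C := by
  obtain ⟨C, hC, h⟩ := exists_tsum_int_decay_le
  refine ⟨C * C, ENNReal.mul_ne_top hC hC, fun a b => ?_⟩
  rw [← (finTwoArrowEquiv ℤ).symm.tsum_eq]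
  simp only [finTwoArrowEquiv_symm_apply, Matrix.cons_val_zero, Matrix.cons_val_one]
  rw [ENNReal.tsum_prod (f := fun n k : ℤ => ENNReal.ofReal (decay (a - n) (b - k)))]
  calc _ = ∑' n : ℤ, ∑' k : ℤ, ENNReal.ofReal ((1 + |a - n|) ^ 2)⁻¹ *
        ENNReal.ofReal ((1 + |b - k|) ^ 2)⁻¹ := by
        refine tsum_congr fun n => tsum_congr fun k => ?_
        rw [← ENNReal.ofReal_mul (by positivity), decay, mul_inv]
    _ ≤ C * C := by
        simp_rw [ENNReal.tsum_mul_left, ENNReal.tsum_mul_right]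
        gcongr
        · exact h a
        · exact h b

lemma abs_apply_le_norm (x : Plane) (i : Fin 2) : |x i| ≤ ‖x‖ := by
  simpa using PiLp.norm_apply_le x i

lemma exists_norm_le_decay (K : 𝓢(Plane, ℂ)) :
    ∃ C : ℝ, 0 ≤ C ∧ ∀ x : Plane, ‖K x‖ ≤ C * decay (x 0) (x 1) := by
  refine ⟨2 ^ 4 * (Finset.Iic ((4, 0) : ℕ × ℕ)).sup (fun m => SchwartzMap.seminorm ℝ m.1 m.2) K,
    by positivity, fun x => ?_⟩
  have h := SchwartzMap.one_add_le_sup_seminorm_apply (𝕜 := ℝ) (m := (4, 0)) (k := 4) (n := 0)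
    le_rfl le_rfl K x
  rw [norm_iteratedFDeriv_zero] at h
  rw [decay, ← div_eq_mul_inv, le_div_iff₀ (by positivity)]
  refine le_trans ?_ h
  rw [mul_comm]
  gcongr
  calc (1 + |x 0|) ^ 2 * (1 + |x 1|) ^ 2 ≤ (1 + ‖x‖) ^ 2 * (1 + ‖x‖) ^ 2 := by
        gcongr <;> exact abs_apply_le_norm x _
    _ = (1 + ‖x‖) ^ 4 := by ring

end Decay

section Weights

lemma iUnion_unitSquare : ⋃ z, unitSquare z = Set.univ :=
  Set.eq_univ_of_forall fun x =>
    Set.mem_iUnion.2 ⟨fun i => round (x i), fun i => abs_sub_round (x i)⟩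

lemma isClosed_unitSquare (z : Fin 2 → ℤ) : IsClosed (unitSquare z) := by
  simp only [unitSquare, Set.ofPred_forall]
  exact isClosed_iInter fun i => isClosed_le (by fun_prop) continuous_const

lemma measurableSet_unitSquare (z : Fin 2 → ℤ) : MeasurableSet (unitSquare z) :=
  (isClosed_unitSquare z).measurableSet

lemma exists_enorm_sub_le_on_unitSquare (K : 𝓢(Plane, ℂ)) :
    ∃ B : ℝ≥0∞, B ≠ ⊤ ∧ ∀ z : Fin 2 → ℤ, ∀ x ∈ unitSquare z, ∀ v : Plane,
      ‖K (x - v)‖ₑ ≤ B * ENNReal.ofReal (decay (v 0 - z 0) (v 1 - z 1)) := by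
  obtain ⟨B, hB, hK⟩ := exists_norm_le_decay K
  refine ⟨ENNReal.ofReal (B * 6), ENNReal.ofReal_ne_top, fun z x hx v => ?_⟩
  rw [← ofReal_norm, ← ENNReal.ofReal_mul (by positivity), mul_assoc, decay_sub_comm]
  refine ENNReal.ofReal_le_ofReal ((hK _).trans ?_)
  gcongr
  exact decay_le_of_close (by simpa using hx 0) (by simpa using hx 1)

lemma exists_lintegral_kernel_le (K : 𝓢(Plane, ℂ)) :
    ∃ C : ℝ≥0∞, C ≠ ⊤ ∧ ∀ (W : Plane → ℝ≥0∞) (M : ℝ≥0∞),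
      (∀ z, ∫⁻ x in unitSquare z, W x ≤ M) →
      ∀ v, ∫⁻ x, ‖K (x - v)‖ₑ * W x ≤ C * M := by
  obtain ⟨B, hB, hK⟩ := exists_enorm_sub_le_on_unitSquare K
  obtain ⟨C, hC, hsum⟩ := exists_tsum_decay_le
  refine ⟨B * C, ENNReal.mul_ne_top hB hC, fun W M hM v => ?_⟩
  let d (z : Fin 2 → ℤ) : ℝ≥0∞ := ENNReal.ofReal (decay (v 0 - z 0) (v 1 - z 1))
  have hsquare (z : Fin 2 → ℤ) :
      ∫⁻ x in unitSquare z, ‖K (x - v)‖ₑ * W x ≤ B * d z * M :=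
    calc _ ≤ ∫⁻ x in unitSquare z, (B * d z) * W x :=
          setLIntegral_mono' (measurableSet_unitSquare z) fun x hx => by
            gcongr; exact hK z x hx v
      _ = B * d z * ∫⁻ x in unitSquare z, W x :=
          lintegral_const_mul' _ _ (ENNReal.mul_ne_top hB ENNReal.ofReal_ne_top)
      _ ≤ B * d z * M := by gcongr; exact hM z
  calc ∫⁻ x, ‖K (x - v)‖ₑ * W x = ∫⁻ x in ⋃ z, unitSquare z, ‖K (x - v)‖ₑ * W x := by
        rw [iUnion_unitSquare, setLIntegral_univ]
    _ ≤ ∑' z, ∫⁻ x in unitSquare z, ‖K (x - v)‖ₑ * W x := lintegral_iUnion_le _ _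
    _ ≤ ∑' z, B * d z * M := ENNReal.tsum_le_tsum hsquare
    _ = B * (∑' z, d z) * M := by rw [ENNReal.tsum_mul_right, ENNReal.tsum_mul_left]
    _ ≤ B * C * M := by gcongr; exact hsum _ _

lemma ae_enorm_sq_le_lintegral_kernel {V : Type*} [NormedAddCommGroup V] [InnerProductSpace ℝ V]
    [FiniteDimensional ℝ V] [MeasurableSpace V] [BorelSpace V] {f : V → ℂ} (hf : Integrable f)
    (hF : Integrable (𝓕 f)) (K : 𝓢(V, ℂ)) (hK : ∀ ζ, 𝓕 f ζ ≠ 0 → 𝓕 (K : V → ℂ) ζ = 1) :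
    ∀ᵐ x, ‖f x‖ₑ ^ 2 ≤ (∫⁻ v, ‖K v‖ₑ) * ∫⁻ v, ‖f v‖ₑ ^ 2 * ‖K (x - v)‖ₑ := by
  filter_upwards [ae_eq_convolution hf hF K hK] with x hx
  have hKm : AEMeasurable fun v => ‖K (x - v)‖ₑ :=
    (K.continuous.comp (continuous_const.sub continuous_id)).enorm.measurable.aemeasurable
  calc ‖f x‖ₑ ^ 2 ≤ (∫⁻ v, ‖f v‖ₑ * ‖K (x - v)‖ₑ) ^ 2 := by
        conv_lhs => rw [hx]
        simp_rw [← enorm_mul]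
        gcongr
        exact enorm_integral_le_lintegral_enorm _
    _ ≤ (∫⁻ v, ‖f v‖ₑ ^ 2 * ‖K (x - v)‖ₑ) * ∫⁻ v, ‖K (x - v)‖ₑ :=
        sq_lintegral_mul_le_lintegral_sq_mul hf.1.enorm hKm
    _ = _ := by rw [lintegral_sub_left_eq_self (fun v => ‖K v‖ₑ) x, mul_comm]

lemma exists_lintegral_weight_le (r : ℝ) :
    ∃ C : ℝ≥0∞, C ≠ ⊤ ∧ ∀ f : Plane → ℂ, Integrable f →
      Function.support (𝓕 f) ⊆ Metric.closedBall 0 r →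
      ∀ W : Plane → ℝ≥0∞, AEMeasurable W → ∀ M : ℝ≥0∞, (∀ z, ∫⁻ x in unitSquare z, W x ≤ M) →
        ∫⁻ x, ‖f x‖ₑ ^ 2 * W x ≤ C * M * ∫⁻ x, ‖f x‖ₑ ^ 2 := by
  obtain ⟨K, hK⟩ := exists_schwartz_fourier_eq_one_on_closedBall (V := Plane) r
  obtain ⟨C, hC, hker⟩ := exists_lintegral_kernel_le K
  have hK1 : ∫⁻ x, ‖K x‖ₑ ≠ ⊤ := (K.integrable (μ := volume)).2.ne
  refine ⟨(∫⁻ x, ‖K x‖ₑ) * C, ENNReal.mul_ne_top hK1 hC, fun f hf hr W hW M hM => ?_⟩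
  have hpointwise := ae_enorm_sq_le_lintegral_kernel hf
    (integrable_fourier_of_support_subset_closedBall hf hr) K fun ζ hζ => hK ζ (hr hζ)
  have hfe : AEMeasurable fun x => ‖f x‖ₑ ^ 2 := hf.1.enorm.pow_const 2
  have hKm (x : Plane) : AEMeasurable fun v => ‖K (x - v)‖ₑ :=
    (K.continuous.comp (continuous_const.sub continuous_id)).enorm.measurable.aemeasurable
  have hmeas : AEMeasurable (fun q : Plane × Plane => ‖f q.2‖ₑ ^ 2 * ‖K (q.1 - q.2)‖ₑ * W q.1)
      (volume.prod volume) :=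
    ((hfe.comp_quasiMeasurePreserving Measure.quasiMeasurePreserving_snd).fun_mul
      (K.continuous.comp (continuous_fst.sub continuous_snd)).enorm.measurable.aemeasurable).fun_mul
      (hW.comp_quasiMeasurePreserving Measure.quasiMeasurePreserving_fst)
  calc _ ≤ ∫⁻ x, (∫⁻ x, ‖K x‖ₑ) * ∫⁻ v, ‖f v‖ₑ ^ 2 * ‖K (x - v)‖ₑ * W x := by
        refine lintegral_mono_ae (hpointwise.mono fun x hx => ?_)
        rw [lintegral_mul_const'' _ (hfe.fun_mul (hKm x)), ← mul_assoc]
        gcongr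
    _ = (∫⁻ x, ‖K x‖ₑ) * ∫⁻ v, ∫⁻ x, ‖f v‖ₑ ^ 2 * ‖K (x - v)‖ₑ * W x := by
        rw [lintegral_const_mul' _ _ hK1, lintegral_lintegral_swap hmeas]
    _ ≤ (∫⁻ x, ‖K x‖ₑ) * ∫⁻ v, ‖f v‖ₑ ^ 2 * (C * M) := by
        gcongr with v
        simp_rw [mul_assoc]
        rw [lintegral_const_mul' _ _ (by simp)]
        gcongr
        exact hker W M hM v
    _ = _ := by rw [lintegral_mul_const'' _ hfe]; ring

lemma exists_lintegral_bilinear_le (r : ℝ) (N : ℕ) :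
    ∃ C : ℝ≥0∞, C ≠ ⊤ ∧ ∀ {ι κ : Type*} {A : Finset ι} {B : Finset κ} {f : ι → Plane → ℂ}
      {g : κ → Plane → ℂ} {δ : ℝ≥0∞}, BoundedOverlap r N A f → BoundedOverlap r N B g →
      (∀ ξ, volume {ζ | (∃ i ∈ A, 𝓕 (f i) ζ ≠ 0) ∧ ∃ j ∈ B, 𝓕 (g j) (ξ - ζ) ≠ 0} ≤ δ) →
      ∀ W : Plane → ℝ≥0∞, AEMeasurable W → ∀ M : ℝ≥0∞, (∀ z, ∫⁻ x in unitSquare z, W x ≤ M) →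
        ∫⁻ x, ‖(∑ i ∈ A, f i x) * ∑ j ∈ B, g j x‖ₑ ^ 2 * W x ≤
          C * M * δ * ((∑ i ∈ A, ∫⁻ x, ‖f i x‖ₑ ^ 2) * ∑ j ∈ B, ∫⁻ x, ‖g j x‖ₑ ^ 2) := by
  obtain ⟨C, hC, hweight⟩ := exists_lintegral_weight_le (r + r)
  refine ⟨C * (N * N), ENNReal.mul_ne_top hC (by simp [ENNReal.mul_eq_top]), ?_⟩
  intro ι κ A B f g δ hA hB hδ W hW M hM
  have hunweighted := lintegral_enorm_sq_mul_le hA.integrable_sum hA.integrable_fourier_sum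
    hB.integrable_sum hB.integrable_fourier_sum (δ := δ) fun ξ =>
      (measure_mono fun ζ (hζ : _ ∧ _) =>
        (⟨hA.exists_fourier_ne_zero hζ.1, hB.exists_fourier_ne_zero hζ.2⟩ : _ ∧ _)).trans (hδ ξ)
  have hweighted := hweight _ (integrable_mul_of_integrable_fourier hA.integrable_sum
      hA.integrable_fourier_sum hB.integrable_sum)
    (support_fourier_mul_subset_closedBall hA.integrable_sum hB.integrable_sum
      hA.support_fourier_sum_subset hB.support_fourier_sum_subset) W hW M hM
  calc _ ≤ C * M * (δ * ((N * ∑ i ∈ A, ∫⁻ x, ‖f i x‖ₑ ^ 2) *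
        (N * ∑ j ∈ B, ∫⁻ x, ‖g j x‖ₑ ^ 2))) := by
        refine hweighted.trans ?_
        gcongr
        refine hunweighted.trans ?_
        gcongr
        · exact hA.lintegral_enorm_sq_sum_le
        · exact hB.lintegral_enorm_sq_sum_le
    _ = _ := by ring

end Weights

section ChangeOfVariables

variable {V : Type*} [NormedAddCommGroup V] [NormedSpace ℝ V] [FiniteDimensional ℝ V]

lemma exists_homeomorph_eq {T : V →ₗ[ℝ] V} (hT : LinearMap.det T ≠ 0) :
    ∃ e : V ≃ₜ V, ⇑e = T :=
  ⟨(T.equivOfDetNeZero hT).toContinuousLinearEquiv.toHomeomorph, rfl⟩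

variable [MeasurableSpace V] [BorelSpace V] {μ : Measure V} [μ.IsAddHaarMeasure]

lemma measurableEmbedding_of_det_ne_zero {T : V →ₗ[ℝ] V} (hT : LinearMap.det T ≠ 0) :
    MeasurableEmbedding T := by
  obtain ⟨e, he⟩ := exists_homeomorph_eq hT
  exact he ▸ e.measurableEmbedding

lemma integral_comp_linearMap {E : Type*} [NormedAddCommGroup E] [NormedSpace ℝ E]
    {T : V →ₗ[ℝ] V} (hT : LinearMap.det T ≠ 0) (h : V → E) :
    ∫ x, h (T x) ∂μ = |(LinearMap.det T)⁻¹| • ∫ x, h x ∂μ := by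
  rw [← (measurableEmbedding_of_det_ne_zero hT).integral_map,
    Measure.map_linearMap_addHaar_eq_smul_addHaar μ hT, integral_smul_measure,
    ENNReal.toReal_ofReal (abs_nonneg _)]

lemma lintegral_comp_linearMap {T : V →ₗ[ℝ] V} (hT : LinearMap.det T ≠ 0) (h : V → ℝ≥0∞) :
    ∫⁻ x, h (T x) ∂μ = ENNReal.ofReal |(LinearMap.det T)⁻¹| * ∫⁻ x, h x ∂μ := by
  rw [← (measurableEmbedding_of_det_ne_zero hT).lintegral_map,
    Measure.map_linearMap_addHaar_eq_smul_addHaar μ hT, lintegral_smul_measure, smul_eq_mul]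

lemma quasiMeasurePreserving_linearMap {T : V →ₗ[ℝ] V} (hT : LinearMap.det T ≠ 0) :
    Measure.QuasiMeasurePreserving T μ μ := by
  refine ⟨(measurableEmbedding_of_det_ne_zero hT).measurable, ?_⟩
  rw [Measure.map_linearMap_addHaar_eq_smul_addHaar μ hT]
  exact Measure.smul_absolutelyContinuous

lemma integrable_comp_linearMap {E : Type*} [NormedAddCommGroup E] {T : V →ₗ[ℝ] V}
    (hT : LinearMap.det T ≠ 0) {h : V → E} (hh : Integrable h μ) :
    Integrable (fun x => h (T x)) μ := by
  refine ((measurableEmbedding_of_det_ne_zero hT).integrable_map_iff (g := h)).1 ?_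
  rw [Measure.map_linearMap_addHaar_eq_smul_addHaar μ hT]
  exact hh.smul_measure ENNReal.ofReal_ne_top

end ChangeOfVariables

section FourierSymmetries

variable {V : Type*} [NormedAddCommGroup V] [InnerProductSpace ℝ V] [FiniteDimensional ℝ V]

lemma contDiff_fourierChar_inner {V : Type*} [NormedAddCommGroup V] [InnerProductSpace ℝ V]
    (v : V) {n : WithTop ℕ∞} :
    ContDiff ℝ n fun w : V => (𝐞 (inner ℝ w v) : ℂ) := by
  simp only [Real.fourierChar_apply]
  exact ((Complex.ofRealCLM.contDiff.comp
    (contDiff_const.mul (contDiff_id.inner ℝ contDiff_const))).mul contDiff_const).cexp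

lemma det_adjoint (T : V →ₗ[ℝ] V) : LinearMap.det T.adjoint = LinearMap.det T := by
  let b := stdOrthonormalBasis ℝ V
  rw [← LinearMap.det_toMatrix b.toBasis, ← LinearMap.det_toMatrix b.toBasis,
    LinearMap.toMatrix_adjoint, Matrix.det_conjTranspose, star_trivial]

variable [MeasurableSpace V] [BorelSpace V] {E : Type*} [NormedAddCommGroup E] [NormedSpace ℂ E]

lemma fourier_comp_linearMap {T : V →ₗ[ℝ] V} (hT : LinearMap.det T ≠ 0) (h : V → E) (x : V) :
    𝓕 (fun ξ => h (T ξ)) (T.adjoint x) = |(LinearMap.det T)⁻¹| • 𝓕 h x := by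
  simp only [Real.fourier_eq, LinearMap.adjoint_inner_right]
  exact integral_comp_linearMap hT fun w => 𝐞 (-inner ℝ w x) • h w

lemma fourier_comp_sub (h : V → E) (v x : V) :
    𝓕 (fun w => h (w - v)) x = 𝐞 (-inner ℝ v x) • 𝓕 h x := by
  have := congrFun (VectorFourier.fourierIntegral_comp_add_right 𝐞 volume (innerₗ V) h (-v)) x
  rw [innerₗ_apply_apply, inner_neg_left] at this
  simp only [sub_eq_add_neg]
  exact this

lemma fourier_fourierChar_smul (h : V → E) (v x : V) :
    𝓕 (fun w => 𝐞 (inner ℝ w v) • h w) x = 𝓕 h (x - v) := by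
  simp only [Real.fourier_eq, smul_smul, ← AddChar.map_add_eq_mul, inner_sub_right, neg_sub,
    neg_add_eq_sub]

lemma norm_fourier_sub_integral_le {f : V → E} (hf : Integrable f) {r : ℝ}
    (hr : ∀ w, f w ≠ 0 → ‖w‖ ≤ r) (y : V) :
    ‖𝓕 f y - ∫ w, f w‖ ≤ 2 * Real.pi * (r * ‖y‖) * ∫ w, ‖f w‖ := by
  rw [Real.fourier_eq, ← integral_sub ((Real.fourierIntegral_convergent_iff y).2 hf) hf,
    ← integral_const_mul]
  refine norm_integral_le_of_norm_le (hf.norm.const_mul _) (.of_forall fun w => ?_)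
  by_cases hw : f w = 0
  · simp [hw]
  have : |inner ℝ w y| ≤ r * ‖y‖ := (abs_real_inner_le_norm w y).trans (by gcongr; exact hr w hw)
  calc ‖𝐞 (-inner ℝ w y) • f w - f w‖ = ‖(𝐞 (-inner ℝ w y) - 1 : ℂ) • f w‖ := by
        rw [sub_smul, one_smul, Circle.smul_def]
    _ ≤ 2 * Real.pi * |inner ℝ w y| * ‖f w‖ := by
        rw [norm_smul, Real.fourierChar_apply, mul_comm _ Complex.I]
        gcongr
        refine Real.norm_exp_I_mul_ofReal_sub_one_le.trans_eq ?_
        rw [Real.norm_eq_abs, abs_mul, abs_neg, abs_of_pos Real.two_pi_pos]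
    _ ≤ 2 * Real.pi * (r * ‖y‖) * ‖f w‖ := by gcongr

lemma exists_schwartz_fourier_adjoint_eq {χ : 𝓢(V, ℂ)} (hχ : HasCompactSupport χ)
    {T : V →ₗ[ℝ] V} (hT : LinearMap.det T ≠ 0) (v z : V) :
    ∃ φ : 𝓢(V, ℂ), (∀ ξ, φ ξ ≠ 0 → χ (T ξ - v) ≠ 0) ∧
      ∀ x, 𝓕 φ (T.adjoint x) = 𝐞 (-inner ℝ v x) • 𝓕 χ (x - z) := by
  set h : V → ℂ := fun w => 𝐞 (inner ℝ w z) • χ w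
  obtain ⟨e, he⟩ := exists_homeomorph_eq hT
  have h_supp : HasCompactSupport fun ξ => h (T ξ - v) := by
    have h_eq : (fun ξ => h (T ξ - v)) = h ∘ e.trans (Homeomorph.subRight v) := by
      ext ξ; simp [he]
    exact h_eq ▸ HasCompactSupport.comp_homeomorph hχ.smul_left _
  have h_smooth : ContDiff ℝ (⊤ : ℕ∞) fun ξ => h (T ξ - v) :=
    ((contDiff_fourierChar_inner z).smul (χ.smooth ⊤)).comp
      (T.toContinuousLinearMap.contDiff.sub contDiff_const)
  refine ⟨|LinearMap.det T| • h_supp.toSchwartzMap h_smooth, fun ξ hξ hχξ => hξ ?_, fun x => ?_⟩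
  · change |LinearMap.det T| • h (T ξ - v) = 0
    simp only [h, hχξ, smul_zero]
  · have : 𝓕 (fun ξ => h (T ξ - v)) (T.adjoint x) =
        |(LinearMap.det T)⁻¹| • 𝐞 (-inner ℝ v x) • 𝓕 χ (x - z) := by
      rw [fourier_comp_linearMap hT fun w => h (w - v), fourier_comp_sub,
        fourier_fourierChar_smul, SchwartzMap.fourier_coe]
    rw [FourierTransform.fourier_smul, smul_apply, SchwartzMap.fourier_coe]
    change |LinearMap.det T| • 𝓕 (fun ξ => h (T ξ - v)) (T.adjoint x) = _
    rw [this, smul_smul, ← abs_mul, mul_inv_cancel₀ hT, abs_one, one_smul]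

end FourierSymmetries

section Tempered

variable {f : Plane → ℂ}

lemma IsTempered.aestronglyMeasurable (hf : IsTempered f) : AEStronglyMeasurable f := by
  obtain ⟨N, hN⟩ := hf
  have h : Continuous fun x : Plane => (1 + ‖x‖) ^ N := by fun_prop
  refine (h.aestronglyMeasurable.smul hN.1).congr (.of_forall fun x => ?_)
  have : (1 + ‖x‖) ^ N ≠ 0 := by positivity
  simp only [Pi.smul_apply', smul_smul, mul_inv_cancel₀ this, one_smul]

lemma IsTempered.integrable_mul (hf : IsTempered f) (Φ : 𝓢(Plane, ℂ)) :
    Integrable fun x => f x * Φ x := by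
  obtain ⟨N, hN⟩ := hf
  have h_bdd (x : Plane) := SchwartzMap.one_add_le_sup_seminorm_apply (𝕜 := ℝ) (m := (N, 0))
    (k := N) (n := 0) le_rfl le_rfl Φ x
  have h_cont : Continuous fun x : Plane => ((1 + ‖x‖) ^ N : ℝ) • Φ x := by
    have := Φ.continuous
    fun_prop
  refine (hN.bdd_mul (c := 2 ^ N * (Finset.Iic ((N, 0) : ℕ × ℕ)).sup
    (fun m => SchwartzMap.seminorm ℝ m.1 m.2) Φ) h_cont.aestronglyMeasurable
    (.of_forall fun x => ?_)).congr (.of_forall fun x => ?_)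
  · rw [norm_smul, norm_pow, Real.norm_of_nonneg (by positivity)]
    simpa only [norm_iteratedFDeriv_zero] using h_bdd x
  · have : (1 + ‖x‖) ^ N ≠ 0 := by positivity
    change ((1 + ‖x‖) ^ N • Φ x) * (((1 + ‖x‖) ^ N)⁻¹ • f x) = f x * Φ x
    rw [smul_mul_smul_comm, mul_inv_cancel₀ this, one_smul, mul_comm]

lemma IsTempered.integrable_mul_smul (hf : IsTempered f) (Φ : 𝓢(Plane, ℂ)) {a : ℝ} (ha : a ≠ 0) :
    Integrable fun x => f x * Φ (a • x) :=
  hf.integrable_mul (SchwartzMap.compCLMOfContinuousLinearEquiv ℝ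
    (ContinuousLinearEquiv.smulLeft (Units.mk0 a ha)) Φ)

end Tempered

section Localized

/-- The function `f` in the coordinates given by `S`, localized by the kernel `𝓕 χ` to the points
within `ρ⁻¹` of `ρ⁻¹ z`, and modulated so that the frequency `η` is moved to the origin. -/
noncomputable def localized (χ : 𝓢(Plane, ℂ)) (f : Plane → ℂ) (S : Plane →ₗ[ℝ] Plane) (ρ : ℝ)
    (z η y : Plane) : ℂ :=
  𝐞 (-inner ℝ η y) • (f (S y) * 𝓕 χ (ρ • y - z))

variable {χ : 𝓢(Plane, ℂ)} {f : Plane → ℂ} {S : Plane →ₗ[ℝ] Plane} {ρ : ℝ}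

lemma exists_schwartz_mul_fourier_eq_localized (hχ : HasCompactSupport χ)
    (hS : LinearMap.det S ≠ 0) (hρ : 0 < ρ) (z η : Plane) :
    ∃ φ : 𝓢(Plane, ℂ),
      (∀ ξ, φ ξ ≠ 0 → χ ((2 * Real.pi * ρ)⁻¹ • (S.adjoint ξ - (2 * Real.pi) • η)) ≠ 0) ∧
      ∀ (f : Plane → ℂ) (y : Plane),
        f (S y) * 𝓕 φ ((2 * Real.pi)⁻¹ • S y) = localized χ f S ρ z η y := by
  have := Real.pi_pos
  set T : Plane →ₗ[ℝ] Plane := (2 * Real.pi * ρ)⁻¹ • S.adjoint with hT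
  have hTdet : LinearMap.det T ≠ 0 := by
    rw [hT, LinearMap.det_smul, det_adjoint]; positivity
  have hTadj (y : Plane) : T.adjoint (ρ • y) = (2 * Real.pi)⁻¹ • S y := by
    rw [hT, map_smulₛₗ LinearMap.adjoint, LinearMap.adjoint_adjoint, LinearMap.smul_apply,
      map_smul, smul_smul, mul_inv, conj_trivial, inv_mul_cancel_right₀ hρ.ne']
  obtain ⟨φ, hφ, hφ_fourier⟩ := exists_schwartz_fourier_adjoint_eq hχ hTdet (ρ⁻¹ • η) z
  refine ⟨φ, fun ξ hξ => ?_, fun f y => ?_⟩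
  · convert hφ ξ hξ using 2
    rw [hT, smul_sub, smul_smul, LinearMap.smul_apply]
    congr 2
    field_simp
  · rw [← hTadj, hφ_fourier, real_inner_smul_left, real_inner_smul_right,
      inv_mul_cancel_left₀ hρ.ne', localized, mul_smul_comm]

lemma integrable_localized (hχ : HasCompactSupport χ) (hf : IsTempered f)
    (hS : LinearMap.det S ≠ 0) (hρ : 0 < ρ) (z η : Plane) :
    Integrable (localized χ f S ρ z η) := by
  obtain ⟨φ, -, hφ⟩ := exists_schwartz_mul_fourier_eq_localized hχ hS hρ z η
  simp only [← funext (hφ f)]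
  exact integrable_comp_linearMap hS
    (hf.integrable_mul_smul (𝓕 φ) (inv_ne_zero Real.two_pi_pos.ne'))

lemma fourier_localized (χ : 𝓢(Plane, ℂ)) (f : Plane → ℂ) (S : Plane →ₗ[ℝ] Plane) (ρ : ℝ)
    (z η ζ : Plane) : 𝓕 (localized χ f S ρ z η) ζ = ∫ y, localized χ f S ρ z (η + ζ) y := by
  simp only [Real.fourier_eq, localized, smul_smul, ← AddChar.map_add_eq_mul, inner_add_left,
    neg_add_rev, real_inner_comm ζ]

lemma exists_mem_of_fourier_localized_ne_zero {δ : ℝ} (hχ : ∀ w, χ w ≠ 0 → ‖w‖ ≤ δ)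
    {K : Set Plane} (hf : HasFourierSupportIn f K) (hS : LinearMap.det S ≠ 0) (hρ : 0 < ρ)
    {z η ζ : Plane} (hζ : 𝓕 (localized χ f S ρ z η) ζ ≠ 0) :
    ∃ ξ ∈ K, ‖S.adjoint ξ - (2 * Real.pi) • (η + ζ)‖ ≤ 2 * Real.pi * ρ * δ := by
  have := Real.pi_pos
  have hχc : HasCompactSupport χ :=
    HasCompactSupport.intro (isCompact_closedBall (0 : Plane) δ) fun w hw => by
      contrapose! hw
      simpa using hχ w hw
  obtain ⟨φ, hφ_supp, hφ⟩ := exists_schwartz_mul_fourier_eq_localized hχc hS hρ z (η + ζ)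
  contrapose! hζ with hfar
  have h_tsupport : tsupport φ ⊆
      {ξ | ‖S.adjoint ξ - (2 * Real.pi) • (η + ζ)‖ ≤ 2 * Real.pi * ρ * δ} := by
    refine closure_minimal (fun ξ hξ => ?_) (isClosed_le ?_ continuous_const)
    · have h := hχ _ (hφ_supp ξ hξ)
      rwa [norm_smul, norm_inv, Real.norm_of_nonneg (by positivity),
        inv_mul_le_iff₀ (by positivity)] at h
    · have := S.adjoint.continuous_of_finiteDimensional
      fun_prop
  have h_pairing : ∫ x, f x * 𝓕 φ ((2 * Real.pi)⁻¹ • x) = 0 :=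
    hf.2 φ fun ξ hξ hξK => absurd (h_tsupport hξ) (not_le.2 (hfar ξ hξK))
  simp only [fourier_localized, ← hφ f]
  rw [integral_comp_linearMap hS fun x => f x * 𝓕 φ ((2 * Real.pi)⁻¹ • x), h_pairing, smul_zero]

lemma norm_le_one_of_abs_apply_le {y : Plane} (hy : ∀ i, |y i| ≤ 1 / 2) : ‖y‖ ≤ 1 := by
  rw [EuclideanSpace.norm_eq, Fin.sum_univ_two, Real.norm_eq_abs, Real.norm_eq_abs]
  exact Real.sqrt_le_one.2 (by nlinarith [hy 0, hy 1, abs_nonneg (y 0), abs_nonneg (y 1)])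

lemma exists_schwartz_one_half_le_norm_fourier :
    ∃ χ : 𝓢(Plane, ℂ), (∀ w, χ w ≠ 0 → ‖w‖ ≤ 1 / 16) ∧
      ∀ y : Plane, (∀ i, |y i| ≤ 1 / 2) → 1 / 2 ≤ ‖𝓕 χ y‖ := by
  let b : ContDiffBump (0 : Plane) := ⟨1 / 32, 1 / 16, by norm_num, by norm_num⟩
  set g : Plane → ℂ := fun x => b.normed volume x
  have hg_supp : HasCompactSupport g :=
    b.hasCompactSupport_normed.comp_left Complex.ofReal_zero
  have hg_smooth : ContDiff ℝ (⊤ : ℕ∞) g := Complex.ofRealCLM.contDiff.comp b.contDiff_normed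
  have hg_ball (w : Plane) (hw : g w ≠ 0) : ‖w‖ ≤ 1 / 16 := by
    have : w ∈ Function.support (b.normed volume) := Complex.ofReal_ne_zero.1 hw
    rw [b.support_normed_eq] at this
    exact (mem_ball_zero_iff.1 this).le
  have hg_integral : ∫ w, g w = 1 := by
    simp only [g, integral_complex_ofReal, b.integral_normed, Complex.ofReal_one]
  have hg_norm : ∫ w, ‖g w‖ = 1 := by
    simp only [g, Complex.norm_real, Real.norm_of_nonneg (b.nonneg_normed _), b.integral_normed]
  refine ⟨hg_supp.toSchwartzMap hg_smooth, hg_ball, fun y hy => ?_⟩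
  have h_close := norm_fourier_sub_integral_le
    (hg_smooth.continuous.integrable_of_hasCompactSupport hg_supp) hg_ball y
  rw [hg_integral, hg_norm, mul_one, norm_sub_rev] at h_close
  rw [SchwartzMap.fourier_coe]
  change 1 / 2 ≤ ‖𝓕 g y‖
  have h_tri := norm_sub_norm_le (1 : ℂ) (𝓕 g y)
  rw [norm_one] at h_tri
  nlinarith [Real.pi_lt_four, Real.pi_pos, norm_le_one_of_abs_apply_le hy, norm_nonneg y]

end Localized

section Rescaling

/-- The lattice point `z` as a point of the plane. -/
noncomputable def latticePoint (z : Fin 2 → ℤ) : Plane := WithLp.toLp 2 fun i => (z i : ℝ)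

variable (s c : ℝ) (y : Plane)

lemma adjoint_rescaling : (rescaling s c).adjoint =
    Matrix.toLpLin 2 2 !![s⁻¹, 0; -2 * c * (s ^ 2)⁻¹, (s ^ 2)⁻¹] := by
  refine (Matrix.toEuclideanLin_conjTranspose_eq_adjoint _).symm.trans (congrArg _ ?_)
  ext i j; fin_cases i <;> fin_cases j <;> simp

lemma adjoint_rescaling_zero : (rescaling s c).adjoint y 0 = s⁻¹ * y 0 := by
  simp [adjoint_rescaling, Matrix.toLpLin_apply, dotProduct, Fin.sum_univ_two]

lemma adjoint_rescaling_one :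
    (rescaling s c).adjoint y 1 = (s ^ 2)⁻¹ * (y 1 - 2 * c * y 0) := by
  simp [adjoint_rescaling, Matrix.toLpLin_apply, dotProduct, Fin.sum_univ_two]; ring

lemma det_rescaling : LinearMap.det (rescaling s c) = (s ^ 3)⁻¹ := by
  rw [rescaling, LinearMap.det_toLpLin, Matrix.det_fin_two_of, pow_succ s 2, mul_inv]; ring

lemma det_rescaling_ne_zero {s : ℝ} (hs : s ≠ 0) (c : ℝ) : LinearMap.det (rescaling s c) ≠ 0 := by
  rw [det_rescaling]; positivity

end Rescaling

section RescaledBlock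

lemma norm_le_abs_add_abs (x : Plane) : ‖x‖ ≤ |x 0| + |x 1| := by
  rw [EuclideanSpace.norm_eq, Fin.sum_univ_two]
  refine Real.sqrt_le_iff.2 ⟨by positivity, ?_⟩
  simp only [Real.norm_eq_abs]
  nlinarith [abs_nonneg (x 0), abs_nonneg (x 1)]

lemma addHaar_le_of_dist_le {V : Type*} [NormedAddCommGroup V] [NormedSpace ℝ V]
    [FiniteDimensional ℝ V] [MeasurableSpace V] [BorelSpace V] (μ : Measure V) [μ.IsAddHaarMeasure]
    {S : Set V} {d : ℝ} (hd : 0 ≤ d) (hS : ∀ x ∈ S, ∀ y ∈ S, dist x y ≤ d) :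
    μ S ≤ ENNReal.ofReal (d ^ Module.finrank ℝ V) * μ (Metric.ball 0 1) := by
  obtain rfl | ⟨x, hx⟩ := S.eq_empty_or_nonempty
  · simp
  · exact (measure_mono fun y hy => hS y hy x hx).trans_eq (Measure.addHaar_closedBall μ x hd)

/-- In coordinates where the block of scale `s` has unit size, the region containing the frequencies
of a localized block of scale `σ s`: a neighbourhood of height `O(σ²)` of the arc of the parabola
over an interval of length `O(σ)` about `X`. The frequencies are those of Mathlib's
normalization of the Fourier transform, hence the factors `2π`. -/
def rescaledBlock (σ X : ℝ) : Set Plane :=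
  {ζ | |2 * Real.pi * ζ 0 - X| ≤ 3 / 2 * σ ∧
    |2 * Real.pi * ζ 1 - (2 * Real.pi * ζ 0) ^ 2| ≤ 25 * σ ^ 2 ∧ |2 * Real.pi * ζ 0| ≤ 22}

variable {σ X : ℝ} {ζ : Plane}

lemma mem_rescaledBlock_of_abs_sub_le {u v : ℝ} (hσ0 : 0 < σ) (hσ1 : σ ≤ 1) (hX : |X| ≤ 20)
    (hu : |u| ≤ 1) (hv : |v| ≤ 2) (h0 : |X + σ * u - 2 * Real.pi * ζ 0| ≤ σ ^ 2 / 2)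
    (h1 : |(X + σ * u) ^ 2 + σ ^ 2 * (v - u ^ 2) - 2 * Real.pi * ζ 1| ≤ σ ^ 2 / 2) :
    ζ ∈ rescaledBlock σ X := by
  have hσ2 : σ ^ 2 ≤ σ := by nlinarith
  rw [rescaledBlock, Set.mem_ofPred_eq]
  generalize 2 * Real.pi * ζ 0 = t at *
  generalize 2 * Real.pi * ζ 1 = q at *
  have hu2 : u ^ 2 ≤ 1 := (sq_le_one_iff_abs_le_one u).2 hu
  have hσu : |σ * u| ≤ σ := by rw [abs_mul, abs_of_pos hσ0]; exact mul_le_of_le_one_right hσ0.le hu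
  have hσv : |σ ^ 2 * (v - u ^ 2)| ≤ σ ^ 2 * 3 := by
    rw [abs_mul, abs_of_pos (by positivity)]
    gcongr
    rw [abs_le] at hv ⊢
    constructor <;> linarith [sq_nonneg u]
  have h_sum : |X + σ * u + t| ≤ 43 := by
    rw [abs_le] at *
    constructor <;> linarith
  have h_sq : |(X + σ * u) ^ 2 - t ^ 2| ≤ 43 * (σ ^ 2 / 2) := by
    rw [sq_sub_sq, abs_mul]
    gcongr
  rw [abs_le] at h0 h1 hX hσu hσv h_sq
  refine ⟨abs_le.2 ⟨?_, ?_⟩, abs_le.2 ⟨?_, ?_⟩, abs_le.2 ⟨?_, ?_⟩⟩ <;> linarith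

lemma rescaledBlock_subset_closedBall (hσ0 : 0 ≤ σ) (hσ1 : σ ≤ 1) :
    rescaledBlock σ X ⊆ Metric.closedBall 0 200 := by
  rintro ζ ⟨-, h1, h0⟩
  have hπ := Real.pi_gt_three
  have h_sq : (2 * Real.pi * ζ 0) ^ 2 ≤ 22 ^ 2 := by rw [← sq_abs]; gcongr
  have h_height : |2 * Real.pi * ζ 1| ≤ 22 ^ 2 + 25 := by
    have := pow_le_one₀ (n := 2) hσ0 hσ1
    rw [abs_le] at h1 ⊢
    constructor <;> linarith [sq_nonneg (2 * Real.pi * ζ 0)]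
  rw [abs_mul, abs_of_pos Real.two_pi_pos] at h0 h_height
  rw [mem_closedBall_zero_iff]
  nlinarith [norm_le_abs_add_abs ζ, abs_nonneg (ζ 0), abs_nonneg (ζ 1)]

lemma card_filter_abs_sub_le (A : Finset ℤ) (x : ℝ) :
    (A.filter fun m : ℤ => |x - m| ≤ 3 / 2).card ≤ 4 := by
  have h_card : (Finset.Icc ⌈x - 3 / 2⌉ ⌊x + 3 / 2⌋).card ≤ 4 := by
    have h : ((⌊x + 3 / 2⌋ - ⌈x - 3 / 2⌉ : ℤ) : ℝ) ≤ 3 := by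
      push_cast
      linarith [Int.floor_le (x + 3 / 2), Int.le_ceil (x - 3 / 2)]
    have : ⌊x + 3 / 2⌋ - ⌈x - 3 / 2⌉ ≤ 3 := mod_cast h
    rw [Int.card_Icc]
    lia
  refine (Finset.card_le_card fun m hm => ?_).trans h_card
  have hm := abs_le.1 (Finset.mem_filter.1 hm).2
  rw [Finset.mem_Icc, Int.ceil_le, Int.le_floor]
  constructor <;> linarith [hm.1, hm.2]

lemma card_filter_le_of_mem_rescaledBlock {r s c : ℝ} (hr : 0 < r) (hs : 0 < s) {A : Finset ℤ}
    {P : ℤ → Prop} [DecidablePred P]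
    (hP : ∀ m ∈ A, P m → ζ ∈ rescaledBlock (r / s) ((r * m - c) / s)) :
    (A.filter P).card ≤ 4 := by
  refine (Finset.card_le_card fun m hm => ?_).trans
    (card_filter_abs_sub_le A ((s * (2 * Real.pi * ζ 0) + c) / r))
  obtain ⟨hmA, hPm⟩ := Finset.mem_filter.1 hm
  have h := (hP m hmA hPm).1
  rw [Finset.mem_filter, show (s * (2 * Real.pi * ζ 0) + c) / r - m =
    (2 * Real.pi * ζ 0 - (r * m - c) / s) * (s / r) by field_simp; ring, abs_mul,
    abs_of_pos (div_pos hs hr), ← le_div_iff₀ (div_pos hs hr)]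
  exact ⟨hmA, h.trans_eq (by field_simp)⟩

/-- Transversality: the two arcs have slopes differing by at least a constant, unless `σ` is itself
bounded below. -/
lemma abs_sub_le_of_fibre (hσ0 : 0 < σ) (hσ1 : σ ≤ 1) {X Y t q t' q' : ℝ}
    (h1 : |q - t ^ 2| ≤ 25 * σ ^ 2) (h2 : |Y - q - (X - t) ^ 2| ≤ 25 * σ ^ 2)
    (h1' : |q' - t' ^ 2| ≤ 25 * σ ^ 2) (h2' : |Y - q' - (X - t') ^ 2| ≤ 25 * σ ^ 2)
    (ht : |t| ≤ 22) (ht' : |t'| ≤ 22)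
    (hsep : 1 / 8 ≤ σ ∨ (1 / 4 ≤ (X - t) - t ∧ 1 / 4 ≤ (X - t') - t')) :
    |t - t'| ≤ 40000 * σ ^ 2 ∧ |q - q'| ≤ 40000 * σ ^ 2 := by
  rcases hsep with h | ⟨h, h'⟩
  · have hσ_large : 1 / 64 ≤ σ ^ 2 := by nlinarith
    have hσ_small : σ ^ 2 ≤ 1 := pow_le_one₀ hσ0.le hσ1
    have ht_sq : t ^ 2 ≤ 22 ^ 2 := by rw [← sq_abs t]; gcongr
    have ht_sq' : t' ^ 2 ≤ 22 ^ 2 := by rw [← sq_abs t']; gcongr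
    rw [abs_le] at h1 h1' ht ht'
    constructor <;> rw [abs_le] <;> constructor <;> linarith [sq_nonneg t, sq_nonneg t']
  · have h_slope : 1 / 2 ≤ |((X - t) - t) + ((X - t') - t')| :=
      le_trans (by linarith) (le_abs_self _)
    have h_prod : |t - t'| * |((X - t) - t) + ((X - t') - t')| ≤ 100 * σ ^ 2 := by
      rw [← abs_mul, show (t - t') * (((X - t) - t) + ((X - t') - t')) =
        t' ^ 2 + (X - t') ^ 2 - (t ^ 2 + (X - t) ^ 2) by ring]
      rw [abs_le] at *
      constructor <;> linarith
    have h_diff : |t - t'| ≤ 200 * σ ^ 2 := by nlinarith [abs_nonneg (t - t')]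
    have h_sq : |t ^ 2 - t' ^ 2| ≤ 44 * (200 * σ ^ 2) := by
      rw [sq_sub_sq, abs_mul]
      gcongr
      exact (abs_add_le _ _).trans (by linarith)
    refine ⟨h_diff.trans (by nlinarith), ?_⟩
    rw [abs_le] at *
    constructor <;> linarith

lemma dist_le_of_fibre (hσ0 : 0 < σ) (hσ1 : σ ≤ 1) {X X' Y Y' : ℝ} {ξ ζ ζ' : Plane}
    (hζ : ζ ∈ rescaledBlock σ X) (hξζ : ξ - ζ ∈ rescaledBlock σ Y)
    (hζ' : ζ' ∈ rescaledBlock σ X') (hξζ' : ξ - ζ' ∈ rescaledBlock σ Y')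
    (hsep : 1 / 8 ≤ σ ∨ (3 * σ + 1 / 4 ≤ Y - X ∧ 3 * σ + 1 / 4 ≤ Y' - X')) :
    dist ζ ζ' ≤ 80000 * σ ^ 2 := by
  obtain ⟨hX, hq, ht⟩ := hζ
  obtain ⟨hX', hq', ht'⟩ := hζ'
  obtain ⟨hY, hp, -⟩ := hξζ
  obtain ⟨hY', hp', -⟩ := hξζ'
  simp only [PiLp.sub_apply, mul_sub (2 * Real.pi)] at hY hY' hp hp'
  obtain ⟨h0, h1⟩ := abs_sub_le_of_fibre hσ0 hσ1 hq hp hq' hp' ht ht' <| hsep.imp_right fun h => by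
    rw [abs_le] at hX hX' hY hY'
    constructor <;> linarith
  rw [← mul_sub, abs_mul, abs_of_pos Real.two_pi_pos] at h0 h1
  rw [dist_eq_norm]
  refine (norm_le_abs_add_abs _).trans ?_
  simp only [PiLp.sub_apply]
  nlinarith [Real.pi_gt_three, abs_nonneg (ζ 0 - ζ' 0), abs_nonneg (ζ 1 - ζ' 1)]

lemma exists_volume_fibre_le : ∃ C : ℝ≥0∞, C ≠ ⊤ ∧ ∀ (σ : ℝ) (𝒳 𝒴 : Set ℝ), 0 < σ → σ ≤ 1 →
    (1 / 8 ≤ σ ∨ ∀ X ∈ 𝒳, ∀ Y ∈ 𝒴, 3 * σ + 1 / 4 ≤ Y - X) → ∀ ξ : Plane,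
      volume {ζ | (∃ X ∈ 𝒳, ζ ∈ rescaledBlock σ X) ∧ ∃ Y ∈ 𝒴, ξ - ζ ∈ rescaledBlock σ Y} ≤
        C * ENNReal.ofReal ((σ ^ 2) ^ 2) := by
  refine ⟨ENNReal.ofReal (80000 ^ 2) * volume (Metric.ball (0 : Plane) 1),
    ENNReal.mul_ne_top ENNReal.ofReal_ne_top measure_ball_lt_top.ne,
    fun σ 𝒳 𝒴 hσ0 hσ1 hsep ξ => ?_⟩
  refine (addHaar_le_of_dist_le volume (d := 80000 * σ ^ 2) (by positivity) ?_).trans_eq ?_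
  · rintro ζ ⟨⟨X, hX, hζ⟩, Y, hY, hξζ⟩ ζ' ⟨⟨X', hX', hζ'⟩, Y', hY', hξζ'⟩
    exact dist_le_of_fibre hσ0 hσ1 hζ hξζ hζ' hξζ'
      (hsep.imp_right fun h => ⟨h X hX Y hY, h X' hX' Y' hY'⟩)
  · rw [finrank_euclideanSpace, Fintype.card_fin, mul_pow, ENNReal.ofReal_mul (by positivity),
      mul_right_comm]

end RescaledBlock

section LocalizedBlocks

/-- The image of the centre `(c, c²)` of a block in the frequency coordinates in which the block
has unit size. -/
noncomputable def centre (s c : ℝ) : Plane := (rescaling s c).adjoint (WithLp.toLp 2 ![c, c ^ 2])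

/-- The function `f`, in coordinates in which the block of scale `s` and centre `(c, c²)` becomes
the unit block at the origin, localized to the image of the `z`-th envelope of that block for the
frequency scale `r = R^{-1/2}`: a square of side `(s / r)² = R s²`. -/
noncomputable def localizedBlock (χ : 𝓢(Plane, ℂ)) (f : Plane → ℂ) (r s c : ℝ)
    (z : Fin 2 → ℤ) : Plane → ℂ :=
  localized χ f (rescaling s c) ((r / s) ^ 2) (latticePoint z) ((2 * Real.pi)⁻¹ • centre s c)

/-- Two sets of blocks of scale `r` near a block of scale `s` and centre `(c, c²)` to which
Córdoba's bilinear estimate applies: they are separated at scale `s`, unless `s` is comparable to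
`r`. -/
structure TransversePair (r s c : ℝ) (A B : Finset ℤ) : Prop where
  pos : 0 < r
  le : r ≤ s
  near_left : ∀ m ∈ A, |r * m - c| ≤ 20 * s
  near_right : ∀ m ∈ B, |r * m - c| ≤ 20 * s
  separated : s ≤ 8 * r ∨ ∀ m ∈ A, ∀ m' ∈ B, 3 * r + s / 4 ≤ r * (m' - m)

variable {χ : 𝓢(Plane, ℂ)} {r s c : ℝ} {A B : Finset ℤ}

lemma TransversePair.pos_scale (h : TransversePair r s c A B) : 0 < s := h.pos.trans_le h.le

lemma mem_rescaledBlock_of_mem_block (hr : 0 < r) (hrs : r ≤ s) {m : ℤ} (hm : |r * m - c| ≤ 20 * s)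
    {ξ ζ : Plane} (hξ : ξ ∈ block r (r * m))
    (hζ : ‖(rescaling s c).adjoint ξ - centre s c - (2 * Real.pi) • ζ‖ ≤ (r / s) ^ 2 / 2) :
    ζ ∈ rescaledBlock (r / s) ((r * m - c) / s) := by
  have hs : 0 < s := hr.trans_le hrs
  obtain ⟨u, v, hu, hv, h0, h1⟩ := hξ
  have e0 := (abs_apply_le_norm _ 0).trans hζ
  have e1 := (abs_apply_le_norm _ 1).trans hζ
  simp only [centre, PiLp.sub_apply, PiLp.smul_apply, smul_eq_mul, adjoint_rescaling_zero,
    adjoint_rescaling_one, Matrix.cons_val_zero, Matrix.cons_val_one, h0, h1] at e0 e1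
  have hX : |(r * m - c) / s| ≤ 20 := by rwa [abs_div, abs_of_pos hs, div_le_iff₀ hs]
  refine mem_rescaledBlock_of_abs_sub_le (by positivity) ((div_le_one hs).2 hrs) hX hu hv ?_ ?_
  · refine (congrArg abs ?_).trans_le e0
    field_simp
    ring
  · refine (congrArg abs ?_).trans_le e1
    field_simp
    ring

lemma mem_rescaledBlock_of_fourier_ne_zero (hχ : ∀ w, χ w ≠ 0 → ‖w‖ ≤ 1 / 16) (hr : 0 < r)
    (hrs : r ≤ s) {m : ℤ} (hm : |r * m - c| ≤ 20 * s) {f : Plane → ℂ}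
    (hf : HasFourierSupportIn f (block r (r * m))) {z : Fin 2 → ℤ} {ζ : Plane}
    (hζ : 𝓕 (localizedBlock χ f r s c z) ζ ≠ 0) :
    ζ ∈ rescaledBlock (r / s) ((r * m - c) / s) := by
  have hs : 0 < s := hr.trans_le hrs
  obtain ⟨ξ, hξ, h⟩ := exists_mem_of_fourier_localized_ne_zero hχ hf
    (det_rescaling_ne_zero hs.ne' c) (by positivity) hζ
  refine mem_rescaledBlock_of_mem_block hr hrs hm hξ ?_
  rw [smul_add, smul_inv_smul₀ Real.two_pi_pos.ne', ← sub_sub] at h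
  refine h.trans ?_
  have : 0 < (r / s) ^ 2 := by positivity
  nlinarith [Real.pi_lt_four]

lemma boundedOverlap_localizedBlock (hχ : ∀ w, χ w ≠ 0 → ‖w‖ ≤ 1 / 16) (hr : 0 < r) (hrs : r ≤ s)
    (hA : ∀ m ∈ A, |r * m - c| ≤ 20 * s) {f : ℤ → Plane → ℂ}
    (hf : ∀ m ∈ A, HasFourierSupportIn (f m) (block r (r * m))) (z : Fin 2 → ℤ) :
    BoundedOverlap 200 4 A fun m => localizedBlock χ (f m) r s c z where
  integrable m hm := integrable_localized
    (HasCompactSupport.intro (isCompact_closedBall (0 : Plane) (1 / 16)) fun w hw => by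
      contrapose! hw
      simpa using hχ w hw)
    (hf m hm).1 (det_rescaling_ne_zero (hr.trans_le hrs).ne' c)
    (by have := hr.trans_le hrs; positivity) _ _
  support_subset m hm ζ hζ :=
    rescaledBlock_subset_closedBall (div_nonneg hr.le (hr.le.trans hrs))
      ((div_le_one (hr.trans_le hrs)).2 hrs)
      (mem_rescaledBlock_of_fourier_ne_zero hχ hr hrs (hA m hm) (hf m hm) hζ)
  card_le ζ := card_filter_le_of_mem_rescaledBlock (ζ := ζ) (c := c) hr (hr.trans_le hrs)
    fun m hm hζ => mem_rescaledBlock_of_fourier_ne_zero hχ hr hrs (hA m hm) (hf m hm) hζ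

lemma exists_lintegral_localizedBlock_le (hχ : ∀ w, χ w ≠ 0 → ‖w‖ ≤ 1 / 16) :
    ∃ C : ℝ≥0∞, C ≠ ⊤ ∧ ∀ (r s c : ℝ) (A B : Finset ℤ) (f : ℤ → Plane → ℂ) (z : Fin 2 → ℤ),
      TransversePair r s c A B →
      (∀ m ∈ A, HasFourierSupportIn (f m) (block r (r * m))) →
      (∀ m ∈ B, HasFourierSupportIn (f m) (block r (r * m))) →
      ∀ W : Plane → ℝ≥0∞, AEMeasurable W → ∀ M : ℝ≥0∞, (∀ z, ∫⁻ x in unitSquare z, W x ≤ M) →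
        ∫⁻ y, ‖(∑ m ∈ A, localizedBlock χ (f m) r s c z y) *
            ∑ m ∈ B, localizedBlock χ (f m) r s c z y‖ₑ ^ 2 * W y ≤
          C * M * ENNReal.ofReal (((r / s) ^ 2) ^ 2) *
            ((∑ m ∈ A, ∫⁻ y, ‖localizedBlock χ (f m) r s c z y‖ₑ ^ 2) *
              ∑ m ∈ B, ∫⁻ y, ‖localizedBlock χ (f m) r s c z y‖ₑ ^ 2) := by
  obtain ⟨C, hC, h_bilinear⟩ := exists_lintegral_bilinear_le 200 4
  obtain ⟨C', hC', h_fibre⟩ := exists_volume_fibre_le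
  refine ⟨C * C', ENNReal.mul_ne_top hC hC', fun r s c A B f z h hA hB W hW M hM => ?_⟩
  have hr := h.pos
  have hs := h.pos_scale
  refine (h_bilinear (δ := C' * ENNReal.ofReal (((r / s) ^ 2) ^ 2))
    (boundedOverlap_localizedBlock hχ h.pos h.le h.near_left hA z)
    (boundedOverlap_localizedBlock hχ h.pos h.le h.near_right hB z)
    (fun ξ => ?_) W hW M hM).trans_eq (by ring)
  let position (m : ℤ) : ℝ := (r * m - c) / s
  refine le_trans (measure_mono ?_) (h_fibre (r / s) (position '' A) (position '' B)
    (by positivity) ((div_le_one hs).2 h.le) (h.separated.imp (fun hrs => ?_) fun hsep => ?_) ξ)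
  · rintro ζ ⟨⟨m, hm, hζ⟩, m', hm', hζ'⟩
    exact ⟨⟨_, ⟨m, hm, rfl⟩,
        mem_rescaledBlock_of_fourier_ne_zero hχ h.pos h.le (h.near_left m hm) (hA m hm) hζ⟩,
      _, ⟨m', hm', rfl⟩,
        mem_rescaledBlock_of_fourier_ne_zero hχ h.pos h.le (h.near_right m' hm') (hB m' hm') hζ'⟩
  · rw [div_le_div_iff₀ (by norm_num) hs]
    linarith
  · rintro _ ⟨m, hm, rfl⟩ _ ⟨m', hm', rfl⟩
    have := hsep m hm m' hm'
    simp only [position]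
    rw [← sub_div, sub_sub_sub_cancel_right, ← mul_sub, le_div_iff₀ hs]
    field_simp
    linarith

end LocalizedBlocks

section CellWeight

/-- The square of side `ρ⁻¹` centred at `ρ⁻¹ z`. For `ρ = (r / s)²` it is an envelope of a block of
scale `s`, in the coordinates in which the tubes of that block are unit squares. -/
def cell (ρ : ℝ) (z : Fin 2 → ℤ) : Set Plane := {y | ρ • y ∈ unitSquare z}

/-- A rapidly decaying majorant of the indicator function of a cell, up to a constant. -/
noncomputable def cellWeight (χ : 𝓢(Plane, ℂ)) (ρ : ℝ) (z : Fin 2 → ℤ) (y : Plane) : ℝ≥0∞ :=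
  ‖𝓕 χ (ρ • y - latticePoint z)‖ₑ ^ 2

lemma measurableSet_cell (ρ : ℝ) (z : Fin 2 → ℤ) : MeasurableSet (cell ρ z) :=
  (measurableSet_unitSquare z).preimage (measurable_const_smul ρ)

lemma iUnion_cell (ρ : ℝ) : ⋃ z, cell ρ z = Set.univ := by
  simp only [cell, ← Set.preimage_ofPred_eq, Set.ofPred_mem_eq, ← Set.preimage_iUnion,
    iUnion_unitSquare, Set.preimage_univ]

variable {χ : 𝓢(Plane, ℂ)} {ρ : ℝ} {z : Fin 2 → ℤ}

lemma measurable_cellWeight (χ : 𝓢(Plane, ℂ)) (ρ : ℝ) (z : Fin 2 → ℤ) :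
    Measurable (cellWeight χ ρ z) :=
  ((𝓕 χ).continuous.comp
    ((continuous_const_smul ρ).sub continuous_const)).enorm.measurable.pow_const 2

lemma one_le_cellWeight (hχ : ∀ y : Plane, (∀ i, |y i| ≤ 1 / 2) → 1 / 2 ≤ ‖𝓕 χ y‖) {y : Plane}
    (hy : y ∈ cell ρ z) : 1 ≤ 4 * cellWeight χ ρ z y := by
  have h_norm : 1 ≤ 2 * ‖𝓕 χ (ρ • y - latticePoint z)‖ := by
    linarith [hχ (ρ • y - latticePoint z) fun i => by simpa [latticePoint] using hy i]
  have h_enorm : 1 ≤ 2 * ‖𝓕 χ (ρ • y - latticePoint z)‖ₑ := by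
    simpa [ENNReal.ofReal_mul] using ENNReal.ofReal_le_ofReal h_norm
  calc 1 ≤ (2 * ‖𝓕 χ (ρ • y - latticePoint z)‖ₑ) ^ 2 := one_le_pow₀ h_enorm
    _ = 4 * cellWeight χ ρ z y := by rw [mul_pow, cellWeight]; norm_num

lemma exists_tsum_cellWeight_le (χ : 𝓢(Plane, ℂ)) :
    ∃ C : ℝ≥0∞, C ≠ ⊤ ∧ ∀ (ρ : ℝ) (y : Plane), ∑' z, cellWeight χ ρ z y ≤ C := by
  obtain ⟨B, -, hχ⟩ := exists_norm_le_decay (𝓕 χ)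
  obtain ⟨C, hC, h_sum⟩ := exists_tsum_decay_le
  refine ⟨ENNReal.ofReal (B ^ 2) * C, ENNReal.mul_ne_top ENNReal.ofReal_ne_top hC, fun ρ y => ?_⟩
  let d (z : Fin 2 → ℤ) : ℝ := decay ((ρ • y) 0 - z 0) ((ρ • y) 1 - z 1)
  have h_term (z : Fin 2 → ℤ) :
      cellWeight χ ρ z y ≤ ENNReal.ofReal (B ^ 2) * ENNReal.ofReal (d z) := by
    rw [cellWeight, ← ofReal_norm, ← ENNReal.ofReal_pow (norm_nonneg _),
      ← ENNReal.ofReal_mul (by positivity)]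
    refine ENNReal.ofReal_le_ofReal ?_
    calc _ ≤ (B * d z) ^ 2 := by gcongr; exact hχ _
      _ = B ^ 2 * d z ^ 2 := mul_pow ..
      _ ≤ B ^ 2 * d z := by
        gcongr
        exact pow_le_of_le_one (decay_nonneg _ _) (decay_le_one _ _) two_ne_zero
  calc _ ≤ ∑' z, ENNReal.ofReal (B ^ 2) * ENNReal.ofReal (d z) := ENNReal.tsum_le_tsum h_term
    _ ≤ _ := by rw [ENNReal.tsum_mul_left]; gcongr; exact h_sum _ _

lemma lintegral_cellWeight (χ : 𝓢(Plane, ℂ)) (hρ : 0 < ρ) (z : Fin 2 → ℤ) :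
    ∫⁻ y, cellWeight χ ρ z y = (ENNReal.ofReal (ρ ^ 2))⁻¹ * ∫⁻ y, ‖𝓕 χ y‖ₑ ^ 2 := by
  have hdet : LinearMap.det (ρ • (LinearMap.id : Plane →ₗ[ℝ] Plane)) = ρ ^ 2 := by
    rw [LinearMap.det_smul, LinearMap.det_id, finrank_euclideanSpace, Fintype.card_fin, mul_one]
  have h := lintegral_comp_linearMap (μ := volume) (hdet.trans_ne (by positivity))
    fun y => ‖𝓕 χ (y - latticePoint z)‖ₑ ^ 2
  rwa [lintegral_sub_right_eq_self (fun y => ‖𝓕 χ y‖ₑ ^ 2), hdet, abs_of_pos (by positivity),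
    ENNReal.ofReal_inv_of_pos (by positivity)] at h

lemma lintegral_enorm_sq_ne_top (K : 𝓢(Plane, ℂ)) : ∫⁻ y, ‖K y‖ₑ ^ 2 ≠ ⊤ := by
  have h := (eLpNorm_lt_top_iff_lintegral_rpow_enorm_lt_top (f := (K : Plane → ℂ))
    (μ := volume) two_ne_zero ENNReal.ofNat_ne_top).1 (K.memLp 2 volume).2
  simpa using h.ne

lemma enorm_localizedBlock_sq (f : Plane → ℂ) (r s c : ℝ) (y : Plane) :
    ‖localizedBlock χ f r s c z y‖ₑ ^ 2 =
      ‖f (rescaling s c y)‖ₑ ^ 2 * cellWeight χ ((r / s) ^ 2) z y := by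
  rw [localizedBlock, localized, ← ofReal_norm, Circle.norm_smul, ofReal_norm, enorm_mul, mul_pow,
    cellWeight]

lemma sum_localizedBlock (A : Finset ℤ) (f : ℤ → Plane → ℂ) (r s c : ℝ) (y : Plane) :
    ∑ m ∈ A, localizedBlock χ (f m) r s c z y =
      localizedBlock χ (fun x => ∑ m ∈ A, f m x) r s c z y := by
  simp only [localizedBlock, localized, ← Finset.smul_sum, Finset.sum_mul]

end CellWeight

section Holder

variable {α : Type*} [MeasurableSpace α] {μ : Measure α} {X S W Ψ : α → ℝ≥0∞} {p : ℝ}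

lemma lintegral_rpow_mul_le (hX : AEMeasurable X μ) (hW : AEMeasurable W μ) (hp : 0 ≤ p)
    (hp4 : p ≤ 4) :
    ∫⁻ x, X x ^ (p / 2) * W x ∂μ ≤
      (∫⁻ x, X x ^ 2 * W x ∂μ) ^ (p / 4) * (∫⁻ x, W x ∂μ) ^ (1 - p / 4) := by
  refine (lintegral_congr fun x => ?_).trans_le <| ENNReal.lintegral_mul_norm_pow_le
    (f := fun x => X x ^ 2 * W x) ((hX.pow_const 2).mul hW) hW (by linarith)
    (by linarith) (add_sub_cancel _ _)
  rw [ENNReal.mul_rpow_of_nonneg _ _ (by linarith), mul_assoc,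
    ← ENNReal.rpow_add_of_nonneg _ _ (by linarith) (by linarith), add_sub_cancel,
    ENNReal.rpow_one, ← ENNReal.rpow_natCast, ← ENNReal.rpow_mul]
  congr 2
  push_cast
  ring

lemma lintegral_mul_rpow_le (hS : AEMeasurable S μ) (hΨ : AEMeasurable Ψ μ) (hp : 2 ≤ p) :
    (∫⁻ x, S x * Ψ x ∂μ) ^ (p / 2) ≤
      (∫⁻ x, S x ^ (p / 2) * Ψ x ∂μ) * (∫⁻ x, Ψ x ∂μ) ^ (p / 2 - 1) := by
  have hp0 : 0 < p := by linarith
  have hp1 : 0 ≤ 1 - 2 / p := by rwa [sub_nonneg, div_le_one hp0]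
  have h : ∫⁻ x, S x * Ψ x ∂μ ≤
      (∫⁻ x, S x ^ (p / 2) * Ψ x ∂μ) ^ (2 / p) * (∫⁻ x, Ψ x ∂μ) ^ (1 - 2 / p) := by
    refine (lintegral_congr fun x => ?_).trans_le <| ENNReal.lintegral_mul_norm_pow_le
      (f := fun x => S x ^ (p / 2) * Ψ x) ((hS.pow_const _).mul hΨ) hΨ (by positivity) hp1
      (add_sub_cancel _ _)
    rw [ENNReal.mul_rpow_of_nonneg _ _ (by positivity), mul_assoc,
      ← ENNReal.rpow_add_of_nonneg _ _ (by positivity) hp1, ← ENNReal.rpow_mul, add_sub_cancel,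
      div_mul_div_cancel₀ two_ne_zero, div_self hp0.ne', ENNReal.rpow_one, ENNReal.rpow_one]
  refine (ENNReal.rpow_le_rpow h (by positivity)).trans_eq ?_
  rw [ENNReal.mul_rpow_of_nonneg _ _ (by positivity), ← ENNReal.rpow_mul, ← ENNReal.rpow_mul,
    div_mul_div_cancel₀ hp0.ne', div_self two_ne_zero, ENNReal.rpow_one, sub_mul,
    div_mul_div_cancel₀ hp0.ne', div_self two_ne_zero, one_mul]

lemma rpow_mul_inv_rpow_mul_inv_rpow {E : ℝ≥0∞} (hE0 : E ≠ 0) (hE : E ≠ ⊤) (p : ℝ) :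
    E ^ (p / 4) * E⁻¹ ^ (1 - p / 4) * E⁻¹ ^ (p / 2 - 1) = 1 := by
  rw [ENNReal.inv_rpow, ENNReal.inv_rpow, ← ENNReal.rpow_neg, ← ENNReal.rpow_neg,
    ← ENNReal.rpow_add _ _ hE0 hE, ← ENNReal.rpow_add _ _ hE0 hE,
    show p / 4 + -(1 - p / 4) + -(p / 2 - 1) = 0 by ring, ENNReal.rpow_zero]

lemma lintegral_rpow_mul_le_of_lintegral_sq_mul_le (hX : AEMeasurable X μ) (hW : AEMeasurable W μ)
    {ν : Measure α} (hS : AEMeasurable S ν) (hΨ : AEMeasurable Ψ ν) (hp : 2 ≤ p) (hp4 : p ≤ 4)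
    {C M E P : ℝ≥0∞} (hE0 : E ≠ 0) (hE : E ≠ ⊤) (hP : ∫⁻ x, Ψ x ∂ν = E⁻¹ * P)
    (h : ∫⁻ x, X x ^ 2 * W x ∂μ ≤ C * M * E * (∫⁻ x, S x * Ψ x ∂ν) ^ 2) :
    ∫⁻ x, X x ^ (p / 2) * W x ∂μ ≤ C ^ (p / 4) * P ^ (p / 2 - 1) *
      (M ^ (p / 4) * (E * ∫⁻ x, W x ∂μ) ^ (1 - p / 4)) * ∫⁻ x, S x ^ (p / 2) * Ψ x ∂ν := by
  have h1 : 0 ≤ 1 - p / 4 := by linarith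
  have h2 : 0 ≤ p / 4 := by linarith
  have h3 : 0 ≤ p / 2 - 1 := by linarith
  set w := ∫⁻ x, W x ∂μ
  set Q := ∫⁻ x, S x * Ψ x ∂ν
  have hQ : (Q ^ 2) ^ (p / 4) ≤ (∫⁻ x, S x ^ (p / 2) * Ψ x ∂ν) * (E⁻¹ * P) ^ (p / 2 - 1) := by
    rw [← ENNReal.rpow_natCast, ← ENNReal.rpow_mul, ← hP,
      show ((2 : ℕ) : ℝ) * (p / 4) = p / 2 by push_cast; ring]
    exact lintegral_mul_rpow_le hS hΨ hp
  calc ∫⁻ x, X x ^ (p / 2) * W x ∂μ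
      ≤ (C * M * E * Q ^ 2) ^ (p / 4) * (E⁻¹ * (E * w)) ^ (1 - p / 4) := by
        rw [ENNReal.inv_mul_cancel_left' (by tauto) (by tauto)]
        refine (lintegral_rpow_mul_le hX hW (by linarith) hp4).trans ?_
        gcongr
    _ = C ^ (p / 4) * (M ^ (p / 4) * (E * w) ^ (1 - p / 4)) *
          (E ^ (p / 4) * E⁻¹ ^ (1 - p / 4)) * (Q ^ 2) ^ (p / 4) := by
        simp only [ENNReal.mul_rpow_of_nonneg _ _ h2, ENNReal.mul_rpow_of_nonneg E⁻¹ _ h1]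
        ring
    _ ≤ C ^ (p / 4) * (M ^ (p / 4) * (E * w) ^ (1 - p / 4)) *
          (E ^ (p / 4) * E⁻¹ ^ (1 - p / 4)) *
          ((∫⁻ x, S x ^ (p / 2) * Ψ x ∂ν) * (E⁻¹ * P) ^ (p / 2 - 1)) := by gcongr
    _ = C ^ (p / 4) * P ^ (p / 2 - 1) * (M ^ (p / 4) * (E * w) ^ (1 - p / 4)) *
          (∫⁻ x, S x ^ (p / 2) * Ψ x ∂ν) *
          (E ^ (p / 4) * E⁻¹ ^ (1 - p / 4) * E⁻¹ ^ (p / 2 - 1)) := by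
        rw [ENNReal.mul_rpow_of_nonneg _ _ h3]
        ring
    _ = _ := by rw [rpow_mul_inv_rpow_mul_inv_rpow hE0 hE, mul_one]

end Holder

section Cells

variable {χ : 𝓢(Plane, ℂ)} {r s c p : ℝ} {A B : Finset ℤ} {f : ℤ → Plane → ℂ}

lemma HasFourierSupportIn.aemeasurable_comp_rescaling {g : Plane → ℂ} {K : Set Plane}
    (hg : HasFourierSupportIn g K) (hs : s ≠ 0) (c : ℝ) :
    AEMeasurable fun y => g (rescaling s c y) :=
  hg.1.aestronglyMeasurable.aemeasurable.comp_quasiMeasurePreserving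
    (quasiMeasurePreserving_linearMap (det_rescaling_ne_zero hs c))

lemma sum_lintegral_localizedBlock_le (hs : s ≠ 0) {G : Finset ℤ} (hGA : G ⊆ A)
    (hf : ∀ m ∈ A, HasFourierSupportIn (f m) (block r (r * m))) (z : Fin 2 → ℤ) :
    ∑ m ∈ G, ∫⁻ y, ‖localizedBlock χ (f m) r s c z y‖ₑ ^ 2 ≤
      ∫⁻ y, (∑ m ∈ A, ‖f m (rescaling s c y)‖ₑ ^ 2) * cellWeight χ ((r / s) ^ 2) z y := by
  simp only [enorm_localizedBlock_sq]
  rw [← lintegral_finsetSum' _ fun m hm =>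
    (((hf m (hGA hm)).aemeasurable_comp_rescaling hs c).enorm.pow_const 2).fun_mul
      (measurable_cellWeight ..).aemeasurable]
  refine lintegral_mono fun y => ?_
  rw [← Finset.sum_mul]
  gcongr

lemma setLIntegral_cell_le (hχ : ∀ y : Plane, (∀ i, |y i| ≤ 1 / 2) → 1 / 2 ≤ ‖𝓕 χ y‖)
    (z : Fin 2 → ℤ) (H : Plane → ℝ≥0∞) :
    ∫⁻ y in cell ((r / s) ^ 2) z,
        ‖(∑ m ∈ A, f m (rescaling s c y)) * ∑ m ∈ B, f m (rescaling s c y)‖ₑ ^ 2 * H y ≤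
      16 * ∫⁻ y, ‖(∑ m ∈ A, localizedBlock χ (f m) r s c z y) *
        ∑ m ∈ B, localizedBlock χ (f m) r s c z y‖ₑ ^ 2 * (cell ((r / s) ^ 2) z).indicator H y := by
  rw [← lintegral_indicator (measurableSet_cell _ z), ← lintegral_const_mul' _ _ (by norm_num)]
  refine lintegral_mono fun y => ?_
  by_cases hy : y ∈ cell ((r / s) ^ 2) z
  · simp only [hy, Set.indicator_of_mem, sum_localizedBlock, enorm_mul, mul_pow,
      enorm_localizedBlock_sq]
    set a := ‖∑ m ∈ A, f m (rescaling s c y)‖ₑ ^ 2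
    set b := ‖∑ m ∈ B, f m (rescaling s c y)‖ₑ ^ 2
    set w := cellWeight χ ((r / s) ^ 2) z y
    calc a * b * H y = 1 * 1 * (a * b * H y) := by rw [one_mul, one_mul]
      _ ≤ 4 * w * (4 * w) * (a * b * H y) := by gcongr <;> exact one_le_cellWeight hχ hy
      _ = 4 * 4 * (a * w * (b * w) * H y) := by ring
      _ = 16 * (a * w * (b * w) * H y) := by norm_num
  · simp [hy]

lemma exists_setLIntegral_cell_sq_le (hχ : ∀ w, χ w ≠ 0 → ‖w‖ ≤ 1 / 16)
    (hχ' : ∀ y : Plane, (∀ i, |y i| ≤ 1 / 2) → 1 / 2 ≤ ‖𝓕 χ y‖) :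
    ∃ C : ℝ≥0∞, C ≠ ⊤ ∧ ∀ (r s c : ℝ) (A B : Finset ℤ) (f : ℤ → Plane → ℂ) (z : Fin 2 → ℤ),
      TransversePair r s c A B →
      (∀ m ∈ A ∪ B, HasFourierSupportIn (f m) (block r (r * m))) →
      ∀ H : Plane → ℝ≥0∞, AEMeasurable H → ∀ M : ℝ≥0∞,
        (∀ z', ∫⁻ y in unitSquare z' ∩ cell ((r / s) ^ 2) z, H y ≤ M) →
        ∫⁻ y in cell ((r / s) ^ 2) z, ‖(∑ m ∈ A, f m (rescaling s c y)) *
            ∑ m ∈ B, f m (rescaling s c y)‖ₑ ^ 2 * H y ≤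
          C * M * ENNReal.ofReal (((r / s) ^ 2) ^ 2) *
            (∫⁻ y, (∑ m ∈ A ∪ B, ‖f m (rescaling s c y)‖ₑ ^ 2) *
              cellWeight χ ((r / s) ^ 2) z y) ^ 2 := by
  obtain ⟨C, hC, h_localized⟩ := exists_lintegral_localizedBlock_le hχ
  refine ⟨16 * C, ENNReal.mul_ne_top (by norm_num) hC, fun r s c A B f z h hf H hH M hM => ?_⟩
  have hcell := measurableSet_cell ((r / s) ^ 2) z
  have hA : A ⊆ A ∪ B := Finset.subset_union_left
  have hB : B ⊆ A ∪ B := Finset.subset_union_right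
  have h_main := h_localized r s c A B f z h (fun m hm => hf m (hA hm)) (fun m hm => hf m (hB hm))
    ((cell ((r / s) ^ 2) z).indicator H) (hH.indicator hcell) M fun z' => by
      rw [setLIntegral_indicator hcell, Set.inter_comm]
      exact hM z'
  refine (setLIntegral_cell_le hχ' z H).trans ?_
  rw [mul_assoc 16, mul_assoc 16, mul_assoc 16]
  gcongr
  refine h_main.trans ?_
  rw [sq (∫⁻ _, _)]
  gcongr
  exacts [sum_lintegral_localizedBlock_le h.pos_scale.ne' hA hf z,
    sum_lintegral_localizedBlock_le h.pos_scale.ne' hB hf z]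

lemma exists_setLIntegral_cell_rpow_le (hχ : ∀ w, χ w ≠ 0 → ‖w‖ ≤ 1 / 16)
    (hχ' : ∀ y : Plane, (∀ i, |y i| ≤ 1 / 2) → 1 / 2 ≤ ‖𝓕 χ y‖) (hp : 2 ≤ p) (hp4 : p ≤ 4) :
    ∃ C : ℝ≥0∞, C ≠ ⊤ ∧ ∀ (r s c : ℝ) (A B : Finset ℤ) (f : ℤ → Plane → ℂ) (z : Fin 2 → ℤ),
      TransversePair r s c A B →
      (∀ m ∈ A ∪ B, HasFourierSupportIn (f m) (block r (r * m))) →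
      ∀ H : Plane → ℝ≥0∞, AEMeasurable H → ∀ M : ℝ≥0∞,
        (∀ z', ∫⁻ y in unitSquare z' ∩ cell ((r / s) ^ 2) z, H y ≤ M) →
        ∫⁻ y in cell ((r / s) ^ 2) z, ‖(∑ m ∈ A, f m (rescaling s c y)) *
            ∑ m ∈ B, f m (rescaling s c y)‖ₑ ^ (p / 2) * H y ≤
          C * (M ^ (p / 4) * (ENNReal.ofReal (((r / s) ^ 2) ^ 2) *
              ∫⁻ y in cell ((r / s) ^ 2) z, H y) ^ (1 - p / 4)) *
            ∫⁻ y, (∑ m ∈ A ∪ B, ‖f m (rescaling s c y)‖ₑ ^ 2) ^ (p / 2) *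
              cellWeight χ ((r / s) ^ 2) z y := by
  obtain ⟨C, hC, h_sq⟩ := exists_setLIntegral_cell_sq_le hχ hχ'
  refine ⟨C ^ (p / 4) * (∫⁻ y, ‖𝓕 χ y‖ₑ ^ 2) ^ (p / 2 - 1), ENNReal.mul_ne_top
    (ENNReal.rpow_ne_top_of_nonneg (by linarith) hC)
    (ENNReal.rpow_ne_top_of_nonneg (by linarith) (lintegral_enorm_sq_ne_top _)),
    fun r s c A B f z h hf H hH M hM => ?_⟩
  have hr := h.pos
  have hs := h.pos_scale
  have hfm (m : ℤ) (hm : m ∈ A ∪ B) : AEMeasurable fun y => f m (rescaling s c y) :=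
    (hf m hm).aemeasurable_comp_rescaling hs.ne' c
  have hXm : AEMeasurable fun y =>
      ‖(∑ m ∈ A, f m (rescaling s c y)) * ∑ m ∈ B, f m (rescaling s c y)‖ₑ :=
    ((Finset.aemeasurable_fun_sum _ fun m hm => hfm m (Finset.mem_union_left _ hm)).mul
      (Finset.aemeasurable_fun_sum _ fun m hm => hfm m (Finset.mem_union_right _ hm))).enorm
  exact lintegral_rpow_mul_le_of_lintegral_sq_mul_le hXm.restrict hH.restrict
    (Finset.aemeasurable_fun_sum _ fun m hm => (hfm m hm).enorm.pow_const 2)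
    (measurable_cellWeight ..).aemeasurable hp hp4
    (ENNReal.ofReal_pos.2 (by positivity)).ne' ENNReal.ofReal_ne_top
    (lintegral_cellWeight χ (by positivity) z) (h_sq r s c A B f z h hf H hH M hM)

/-- `K` stands for the `p`-th power of the weight parameter. -/
lemma exists_lintegral_transversePair_le (hp : 2 ≤ p) (hp4 : p ≤ 4) :
    ∃ C : ℝ≥0∞, C ≠ ⊤ ∧ ∀ (r s c : ℝ) (A B : Finset ℤ) (f : ℤ → Plane → ℂ),
      TransversePair r s c A B →
      (∀ m ∈ A ∪ B, HasFourierSupportIn (f m) (block r (r * m))) →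
      ∀ H : Plane → ℝ≥0∞, AEMeasurable H → ∀ K : ℝ≥0∞,
        (∀ z, ∃ M : ℝ≥0∞,
          (∀ z', ∫⁻ y in unitSquare z' ∩ cell ((r / s) ^ 2) z, H (rescaling s c y) ≤ M) ∧
          M ^ (p / 4) * (ENNReal.ofReal (((r / s) ^ 2) ^ 2) *
            ∫⁻ y in cell ((r / s) ^ 2) z, H (rescaling s c y)) ^ (1 - p / 4) ≤ K) →
        ∫⁻ x, ‖(∑ m ∈ A, f m x) * ∑ m ∈ B, f m x‖ₑ ^ (p / 2) * H x ≤
          C * K * ∫⁻ x, (∑ m ∈ A ∪ B, ‖f m x‖ₑ ^ 2) ^ (p / 2) := by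
  obtain ⟨χ, hχ, hχ'⟩ := exists_schwartz_one_half_le_norm_fourier
  obtain ⟨C, hC, h_cell⟩ := exists_setLIntegral_cell_rpow_le hχ hχ' hp hp4
  obtain ⟨C', hC', h_tsum⟩ := exists_tsum_cellWeight_le χ
  refine ⟨C * C', ENNReal.mul_ne_top hC hC', fun r s c A B f h hf H hH K hK => ?_⟩
  have hdet := det_rescaling_ne_zero h.pos_scale.ne' c
  set ρ := (r / s) ^ 2
  let X (x : Plane) : ℝ≥0∞ := ‖(∑ m ∈ A, f m x) * ∑ m ∈ B, f m x‖ₑ ^ (p / 2) * H x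
  let S (x : Plane) : ℝ≥0∞ := (∑ m ∈ A ∪ B, ‖f m x‖ₑ ^ 2) ^ (p / 2)
  have hS : AEMeasurable fun y => S (rescaling s c y) :=
    (Finset.aemeasurable_fun_sum _ fun m hm =>
      ((hf m hm).aemeasurable_comp_rescaling h.pos_scale.ne' c).enorm.pow_const 2).pow_const _
  have h_rescaled : ∫⁻ y, X (rescaling s c y) ≤ C * C' * K * ∫⁻ y, S (rescaling s c y) := by
    calc ∫⁻ y, X (rescaling s c y) ≤ ∑' z, ∫⁻ y in cell ρ z, X (rescaling s c y) := by
          rw [← setLIntegral_univ, ← iUnion_cell ρ]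
          exact lintegral_iUnion_le _ _
      _ ≤ ∑' z, C * K * ∫⁻ y, S (rescaling s c y) * cellWeight χ ρ z y := by
          refine ENNReal.tsum_le_tsum fun z => ?_
          obtain ⟨M, hM, hMK⟩ := hK z
          refine (h_cell r s c A B f z h hf _
            (hH.comp_quasiMeasurePreserving (quasiMeasurePreserving_linearMap hdet)) M hM).trans ?_
          gcongr
          exact hMK
      _ = C * K * ∫⁻ y, S (rescaling s c y) * ∑' z, cellWeight χ ρ z y := by
          rw [ENNReal.tsum_mul_left,
            ← lintegral_tsum fun z => hS.fun_mul (measurable_cellWeight ..).aemeasurable]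
          simp_rw [ENNReal.tsum_mul_left]
      _ ≤ C * K * ∫⁻ y, S (rescaling s c y) * C' := by gcongr; exact h_tsum ρ _
      _ = C * C' * K * ∫⁻ y, S (rescaling s c y) := by rw [lintegral_mul_const'' _ hS]; ring
  have hD : ENNReal.ofReal |(LinearMap.det (rescaling s c))⁻¹| ≠ 0 :=
    (ENNReal.ofReal_pos.2 (abs_pos.2 (inv_ne_zero hdet))).ne'
  rw [lintegral_comp_linearMap hdet X, lintegral_comp_linearMap hdet S, mul_left_comm] at h_rescaled
  exact (ENNReal.mul_le_mul_iff_right hD ENNReal.ofReal_ne_top).1 h_rescaled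

end Cells

section Kappa

lemma volume_unitSquare (z : Fin 2 → ℤ) : volume (unitSquare z) = 1 := by
  have h_preimage : unitSquare z = (MeasurableEquiv.toLp 2 (Fin 2 → ℝ)).symm ⁻¹'
      (Set.Icc (fun i => (z i : ℝ) - 1 / 2) fun i => (z i : ℝ) + 1 / 2) := by
    ext x
    simp only [unitSquare, Set.mem_ofPred_eq, Set.mem_preimage, Set.mem_Icc, Pi.le_def, abs_le,
      ← forall_and]
    refine forall_congr' fun i => ?_
    rw [neg_le_sub_iff_le_add, sub_le_iff_le_add', sub_le_iff_le_add]
    rfl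
  rw [h_preimage, (EuclideanSpace.volume_preserving_symm_measurableEquiv_toLp _).measure_preimage
    measurableSet_Icc.nullMeasurableSet, Real.volume_Icc_pi]
  norm_num

lemma volume_cell {ρ : ℝ} (hρ : 0 < ρ) (z : Fin 2 → ℤ) :
    volume (cell ρ z) = ENNReal.ofReal ((ρ ^ 2)⁻¹) := by
  have h := Measure.addHaar_preimage_smul volume hρ.ne' (unitSquare z)
  rwa [volume_unitSquare, finrank_euclideanSpace, Fintype.card_fin, mul_one,
    abs_of_pos (by positivity)] at h

section Image

variable {V : Type*} [NormedAddCommGroup V] [NormedSpace ℝ V] [FiniteDimensional ℝ V]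
  [MeasurableSpace V] [BorelSpace V] {μ : Measure V} [μ.IsAddHaarMeasure] {T : V →ₗ[ℝ] V}

lemma measure_image_linearMap_ne_top {X : Set V} (hX : μ X ≠ ⊤) : μ (T '' X) ≠ ⊤ := by
  rw [Measure.addHaar_image_linearMap]
  exact ENNReal.mul_ne_top ENNReal.ofReal_ne_top hX

lemma setIntegral_image_linearMap_div_measureReal (hT : LinearMap.det T ≠ 0) {X : Set V}
    (hX : MeasurableSet X) (Y : Set V) (H : V → ℝ) :
    (∫ x in T '' X, H x ∂μ) / μ.real (T '' Y) = (∫ y in X, H (T y) ∂μ) / μ.real Y := by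
  have hdet : |LinearMap.det T| ≠ 0 := abs_ne_zero.2 hT
  have h := integral_image_eq_integral_abs_det_fderiv_smul μ hX (f := T)
    (f' := fun _ => LinearMap.toContinuousLinearMap T)
    (fun x _ => (LinearMap.toContinuousLinearMap T).hasFDerivWithinAt)
    (measurableEmbedding_of_det_ne_zero hT).injective.injOn H
  simp only [LinearMap.det_toContinuousLinearMap, smul_eq_mul, integral_const_mul] at h
  rw [h, Measure.real, Measure.addHaar_image_linearMap, ENNReal.toReal_mul,
    ENNReal.toReal_ofReal (abs_nonneg _), mul_div_mul_left _ _ hdet, Measure.real]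

end Image

section UnitInterval

variable {α : Type*} [MeasurableSpace α] {μ : Measure α} {H : α → ℝ} {S T : Set α}

lemma setIntegral_div_measureReal_mem_Icc (hH : ∀ x, H x ∈ Set.Icc (0 : ℝ) 1) (hST : S ⊆ T)
    (hT : μ T ≠ ⊤) : (∫ x in S, H x ∂μ) / μ.real T ∈ Set.Icc (0 : ℝ) 1 := by
  have h0 : 0 ≤ ∫ x in S, H x ∂μ := integral_nonneg fun x => (hH x).1
  refine ⟨div_nonneg h0 measureReal_nonneg, div_le_one_of_le₀ ?_ measureReal_nonneg⟩
  have h1 := norm_setIntegral_le_of_norm_le_const (μ := μ) (f := H) (C := 1)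
    ((measure_mono hST).trans_lt hT.lt_top) fun x _ => by
      rw [Real.norm_eq_abs, abs_of_nonneg (hH x).1]; exact (hH x).2
  rw [one_mul, Real.norm_of_nonneg h0] at h1
  exact h1.trans (measureReal_mono hST hT)

lemma ofReal_setIntegral_eq_setLIntegral (hHm : AEMeasurable H μ)
    (hH : ∀ x, H x ∈ Set.Icc (0 : ℝ) 1) (hS : μ S ≠ ⊤) :
    ENNReal.ofReal (∫ x in S, H x ∂μ) = ∫⁻ x in S, ENNReal.ofReal (H x) ∂μ := by
  refine ofReal_integral_eq_lintegral_ofReal ?_ (.of_forall fun x => (hH x).1)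
  refine Measure.integrableOn_of_bounded (M := 1) hS hHm.aestronglyMeasurable
    (.of_forall fun x => ?_)
  rw [Real.norm_of_nonneg (hH x).1]
  exact (hH x).2

end UnitInterval

variable {R s c p : ℝ} {H : Plane → ℝ} {U : Set Plane}

lemma scales_pos (hR : 0 < R) (hs : s ∈ scales R) : 0 < s :=
  (inv_pos.2 (Real.sqrt_pos.2 hR)).trans_le hs.2

lemma volume_envelope_ne_top (hU : U ∈ envelopes R s c) : volume U ≠ ⊤ := by
  obtain ⟨_, ⟨z, rfl⟩, rfl⟩ := hU
  rw [Measure.addHaar_smul]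
  refine ENNReal.mul_ne_top ENNReal.ofReal_ne_top (measure_image_linearMap_ne_top ?_)
  rw [volume_unitSquare]
  exact ENNReal.one_ne_top

lemma rescaling_image_cell_mem_envelopes (hR : 0 < R) (hs : 0 < s) (c : ℝ) (z : Fin 2 → ℤ) :
    rescaling s c '' cell (((√R)⁻¹ / s) ^ 2) z ∈ envelopes R s c := by
  refine ⟨rescaling s c '' unitSquare z, ⟨z, rfl⟩, ?_⟩
  have hρ : ((√R)⁻¹ / s) ^ 2 = (R * s ^ 2)⁻¹ := by
    rw [div_pow, inv_pow, Real.sq_sqrt hR.le, mul_inv, div_eq_mul_inv]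
  have hcell : cell (R * s ^ 2)⁻¹ z = (R * s ^ 2) • unitSquare z :=
    Set.preimage_smul_inv₀ (by positivity) _
  rw [hρ, hcell]
  exact Set.image_smul_comm _ _ _ fun y => map_smul _ _ y

lemma kappa_term_mem_Icc (hH : ∀ x, H x ∈ Set.Icc (0 : ℝ) 1) (hp : 0 < p) (hp4 : p ≤ 4)
    (hU : volume U ≠ ⊤) (T : tubes s c) :
    ((∫ x in (T : Set Plane) ∩ U, H x) / volume.real (T : Set Plane)) ^ (1 / 4 : ℝ) *
      ((∫ x in U, H x) / volume.real U) ^ (1 / p - 1 / 4) ∈ Set.Icc (0 : ℝ) 1 := by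
  obtain ⟨T, z, rfl⟩ := T
  have hT : volume (rescaling s c '' unitSquare z) ≠ ⊤ :=
    measure_image_linearMap_ne_top (by rw [volume_unitSquare]; exact ENNReal.one_ne_top)
  have ha := setIntegral_div_measureReal_mem_Icc hH (Set.inter_subset_left (t := U)) hT
  have hb := setIntegral_div_measureReal_mem_Icc hH subset_rfl hU
  exact unitInterval.mul_mem
    ⟨Real.rpow_nonneg ha.1 _, Real.rpow_le_one ha.1 ha.2 (by norm_num)⟩
    ⟨Real.rpow_nonneg hb.1 _, Real.rpow_le_one hb.1 hb.2
      (sub_nonneg.2 (one_div_le_one_div_of_le hp hp4))⟩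

lemma kappa_mem_Icc (hH : ∀ x, H x ∈ Set.Icc (0 : ℝ) 1) (hp : 0 < p) (hp4 : p ≤ 4)
    (hU : volume U ≠ ⊤) : kappa p H s c U ∈ Set.Icc (0 : ℝ) 1 :=
  ⟨Real.iSup_nonneg fun T => (kappa_term_mem_Icc hH hp hp4 hU T).1,
    Real.iSup_le (fun T => (kappa_term_mem_Icc hH hp hp4 hU T).2) zero_le_one⟩

lemma kappa_term_le_kappaSup (hH : ∀ x, H x ∈ Set.Icc (0 : ℝ) 1) (hp : 0 < p) (hp4 : p ≤ 4)
    (hs : s ∈ scales R) {m : ℤ} (hm : m ∈ blockIndices s) (hU : U ∈ envelopes R s (s * m))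
    (T : tubes s (s * m)) :
    ((∫ x in (T : Set Plane) ∩ U, H x) / volume.real (T : Set Plane)) ^ (1 / 4 : ℝ) *
      ((∫ x in U, H x) / volume.real U) ^ (1 / p - 1 / 4) ≤ kappaSup p H R := by
  calc _ ≤ kappa p H s (s * m) U := by
        refine le_ciSup (f := fun T : tubes s (s * m) =>
          ((∫ x in (T : Set Plane) ∩ U, H x) / volume.real (T : Set Plane)) ^ (1 / 4 : ℝ) *
            ((∫ x in U, H x) / volume.real U) ^ (1 / p - 1 / 4)) ⟨1, ?_⟩ T
        rintro _ ⟨T, rfl⟩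
        exact (kappa_term_mem_Icc hH hp hp4 (volume_envelope_ne_top hU) T).2
    _ ≤ kappaSup p H R := by
        refine le_csSup ⟨1, ?_⟩ ⟨s, hs, m, hm, U, hU, rfl⟩
        rintro _ ⟨s, -, m, -, U, hU, rfl⟩
        exact (kappa_mem_Icc hH hp hp4 (volume_envelope_ne_top hU)).2

lemma rpow_lintegral_cell_le_kappaSup (hR : 0 < R) (hHm : AEMeasurable H)
    (hH : ∀ x, H x ∈ Set.Icc (0 : ℝ) 1) (hp : 0 < p) (hp4 : p ≤ 4) (hs : s ∈ scales R) {m : ℤ}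
    (hm : m ∈ blockIndices s) (z z' : Fin 2 → ℤ) :
    (∫⁻ y in unitSquare z' ∩ cell (((√R)⁻¹ / s) ^ 2) z,
        ENNReal.ofReal (H (rescaling s (s * m) y))) ^ (1 / 4 : ℝ) *
      (ENNReal.ofReal ((((√R)⁻¹ / s) ^ 2) ^ 2) * ∫⁻ y in cell (((√R)⁻¹ / s) ^ 2) z,
        ENNReal.ofReal (H (rescaling s (s * m) y))) ^ (1 / p - 1 / 4) ≤
      ENNReal.ofReal (kappaSup p H R) := by
  have hs0 := scales_pos hR hs
  have hdet := det_rescaling_ne_zero hs0.ne' (s * m)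
  have h := kappa_term_le_kappaSup hH hp hp4 hs hm
    (rescaling_image_cell_mem_envelopes hR hs0 _ z) ⟨_, z', rfl⟩
  set ρ := ((√R)⁻¹ / s) ^ 2
  have hρ : 0 < ρ := by positivity
  have hcell : volume (cell ρ z) ≠ ⊤ := by rw [volume_cell hρ]; exact ENNReal.ofReal_ne_top
  have hHT : AEMeasurable fun y => H (rescaling s (s * m) y) :=
    hHm.comp_quasiMeasurePreserving (quasiMeasurePreserving_linearMap hdet)
  have h_ofReal {X : Set Plane} (hX : X ⊆ cell ρ z) :
      ENNReal.ofReal (∫ y in X, H (rescaling s (s * m) y)) =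
        ∫⁻ y in X, ENNReal.ofReal (H (rescaling s (s * m) y)) :=
    ofReal_setIntegral_eq_setLIntegral hHT (fun y => hH _)
      ((measure_mono hX).trans_lt hcell.lt_top).ne
  have h_nonneg (X : Set Plane) : 0 ≤ ∫ y in X, H (rescaling s (s * m) y) :=
    integral_nonneg fun y => (hH _).1
  rw [← Set.image_inter (measurableEmbedding_of_det_ne_zero hdet).injective,
    setIntegral_image_linearMap_div_measureReal hdet
      ((measurableSet_unitSquare z').inter (measurableSet_cell ρ z)),
    setIntegral_image_linearMap_div_measureReal hdet (measurableSet_cell ρ z), Measure.real,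
    Measure.real, volume_unitSquare, volume_cell hρ, ENNReal.toReal_ofReal (by positivity),
    ENNReal.toReal_one, div_one, div_inv_eq_mul, mul_comm _ (ρ ^ 2)] at h
  have hb := mul_nonneg (sq_nonneg ρ) (h_nonneg (cell ρ z))
  rw [← h_ofReal Set.inter_subset_right, ← h_ofReal subset_rfl, ← ENNReal.ofReal_mul (sq_nonneg ρ),
    ENNReal.ofReal_rpow_of_nonneg (h_nonneg _) (by norm_num), ENNReal.ofReal_rpow_of_nonneg hb
      (sub_nonneg.2 (one_div_le_one_div_of_le hp hp4)),
    ← ENNReal.ofReal_mul (Real.rpow_nonneg (h_nonneg _) _)]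
  exact ENNReal.ofReal_le_ofReal h

lemma exists_bound_rpow_mul_rpow_le {ι : Type*} {a : ι → ℝ≥0∞} {b κ : ℝ≥0∞} (hp : 0 < p)
    (h : ∀ i, a i ^ (1 / 4 : ℝ) * b ^ (1 / p - 1 / 4) ≤ κ) :
    ∃ M : ℝ≥0∞, (∀ i, a i ≤ M) ∧ M ^ (p / 4) * b ^ (1 - p / 4) ≤ κ ^ p := by
  refine ⟨⨆ i, a i, le_iSup a, ?_⟩
  have h_iSup : (⨆ i, a i) ^ (1 / 4 : ℝ) * b ^ (1 / p - 1 / 4) ≤ κ := by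
    have h_rpow : (⨆ i, a i) ^ (1 / 4 : ℝ) = ⨆ i, a i ^ (1 / 4 : ℝ) :=
      (ENNReal.orderIsoRpow (1 / 4) (by norm_num)).map_iSup a
    rw [h_rpow, ENNReal.iSup_mul]
    exact iSup_le h
  calc _ = ((⨆ i, a i) ^ (1 / 4 : ℝ) * b ^ (1 / p - 1 / 4)) ^ p := by
        rw [ENNReal.mul_rpow_of_nonneg _ _ hp.le, ← ENNReal.rpow_mul, ← ENNReal.rpow_mul]
        congr 2 <;> field_simp
    _ ≤ κ ^ p := by gcongr

end Kappa

section BroadNarrow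

/-- The indices of `S` in the `k`-th dyadic interval of length `2 ^ i`: the blocks contained in the
`k`-th dyadic arc. -/
def dyadicPart (S : Finset ℤ) (i : ℕ) (k : ℤ) : Finset ℤ := {m ∈ S | m / 2 ^ i = k}

/-- The scales `i` and gaps `d` of the pairs of dyadic intervals `k`, `k + d` of length `2 ^ i` used
in the broad-narrow decomposition with `n` scales: non-adjacent intervals with adjacent parents,
and at the finest scale `i = 2` also pairs of equal intervals. -/
def dyadicGaps (n : ℕ) : Finset (ℕ × ℤ) := insert (2, 0) (Finset.Ico 2 n ×ˢ {2, 3})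

variable {S : Finset ℤ} {i n : ℕ} {k d : ℤ}

lemma dyadicPart_subset : dyadicPart S i k ⊆ S := Finset.filter_subset _ _

lemma mem_dyadicPart_iff {m : ℤ} :
    m ∈ dyadicPart S i k ↔ m ∈ S ∧ k * 2 ^ i ≤ m ∧ m < (k + 1) * 2 ^ i := by
  have hpos : (0 : ℤ) < 2 ^ i := by positivity
  rw [dyadicPart, Finset.mem_filter, Int.ediv_eq_iff_of_pos hpos, add_one_mul]

lemma mem_dyadicGaps_iff :
    (i, d) ∈ dyadicGaps n ↔ (i = 2 ∧ d = 0) ∨ (2 ≤ i ∧ i < n) ∧ (d = 2 ∨ d = 3) := by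
  simp only [dyadicGaps, Finset.mem_insert, Finset.mem_product, Finset.mem_Ico, Prod.mk.injEq,
    Finset.mem_singleton]

lemma card_dyadicGaps_le (hn : 2 ≤ n) : (dyadicGaps n).card ≤ 2 * n := by
  refine (Finset.card_insert_le _ _).trans ?_
  rw [Finset.card_product, Nat.card_Ico, Finset.card_pair (by decide)]
  lia

section AddCommMonoid

variable {E : Type*} [AddCommMonoid E] (a : ℤ → E)

lemma sum_dyadicPart_succ :
    ∑ m ∈ dyadicPart S (i + 1) k, a m =
      ∑ m ∈ dyadicPart S i (2 * k), a m + ∑ m ∈ dyadicPart S i (2 * k + 1), a m := by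
  have h_disj : Disjoint (dyadicPart S i (2 * k)) (dyadicPart S i (2 * k + 1)) :=
    Finset.disjoint_filter.2 fun _ _ => by lia
  rw [← Finset.sum_union h_disj, dyadicPart, dyadicPart, dyadicPart, ← Finset.filter_or]
  refine Finset.sum_congr (Finset.filter_congr fun m _ => ?_) fun _ _ => rfl
  rw [pow_succ, ← Int.ediv_ediv_of_nonneg (by positivity)]
  lia

lemma sum_eq_sum_dyadicPart_neg_one_add (hS : ∀ m ∈ S, -2 ^ n ≤ m ∧ m < 2 ^ n) :
    ∑ m ∈ S, a m = ∑ m ∈ dyadicPart S n (-1), a m + ∑ m ∈ dyadicPart S n 0, a m := by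
  have h_disj : Disjoint (dyadicPart S n (-1)) (dyadicPart S n 0) :=
    Finset.disjoint_filter.2 fun _ _ => by lia
  rw [← Finset.sum_union h_disj]
  refine Finset.sum_congr (Finset.ext fun m => ?_) fun _ _ => rfl
  rw [Finset.mem_union, mem_dyadicPart_iff, mem_dyadicPart_iff]
  have := hS m
  grind

end AddCommMonoid

variable {E : Type*} [SeminormedAddCommGroup E]

lemma norm_add_four_le {a b c d : E} {X B : ℝ} (hB : 0 ≤ B)
    (hab : ‖a + b‖ ≤ X) (hbc : ‖b + c‖ ≤ X) (hcd : ‖c + d‖ ≤ X)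
    (hac : ‖a‖ * ‖c‖ ≤ B ^ 2) (had : ‖a‖ * ‖d‖ ≤ B ^ 2) (hbd : ‖b‖ * ‖d‖ ≤ B ^ 2) :
    ‖a + b + (c + d)‖ ≤ X + 2 * B := by
  have h_min {x y : E} (h : ‖x‖ * ‖y‖ ≤ B ^ 2) : ‖x‖ ≤ B ∨ ‖y‖ ≤ B := by
    by_contra! hxy
    exact (mul_lt_mul'' hxy.1 hxy.2 hB hB).not_ge (h.trans_eq (sq B))
  have h_left : ‖a + b + (c + d)‖ ≤ ‖a + b‖ + ‖c‖ + ‖d‖ := by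
    rw [← add_assoc]
    exact norm_add₃_le
  have h_right : ‖a + b + (c + d)‖ ≤ ‖a‖ + ‖b‖ + ‖c + d‖ := norm_add₃_le
  have h_middle : ‖a + b + (c + d)‖ ≤ ‖a‖ + ‖b + c‖ + ‖d‖ := by
    rw [show a + b + (c + d) = a + (b + c) + d by abel]
    exact norm_add₃_le
  rcases h_min hac with h | h <;> rcases h_min had with h' | h' <;>
    rcases h_min hbd with h'' | h'' <;> linarith

variable {a : ℤ → E} {B : ℝ}

lemma norm_sum_dyadicPart_add_le (hB : 0 ≤ B) (hn : 2 ≤ n)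
    (h : ∀ i d, (i, d) ∈ dyadicGaps n → ∀ k,
      ‖∑ m ∈ dyadicPart S i k, a m‖ * ‖∑ m ∈ dyadicPart S i (k + d), a m‖ ≤ B ^ 2)
    (hi : 2 ≤ i) (hin : i ≤ n) (k : ℤ) :
    ‖∑ m ∈ dyadicPart S i k, a m + ∑ m ∈ dyadicPart S i (k + 1), a m‖ ≤
      (1 + 2 / n) ^ i * (n * B) := by
  have hn2 : (2 : ℝ) ≤ n := mod_cast hn
  have hnB {j : ℕ} : n * B ≤ (1 + 2 / n) ^ j * (n * B) :=
    le_mul_of_one_le_left (by positivity) (one_le_pow₀ (le_add_of_nonneg_right (by positivity)))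
  induction i, hi using Nat.le_induction generalizing k with
  | base =>
    have h_piece (k : ℤ) : ‖∑ m ∈ dyadicPart S 2 k, a m‖ ≤ B := by
      have := h 2 0 (mem_dyadicGaps_iff.2 (by simp)) k
      rw [add_zero, ← sq] at this
      exact (sq_le_sq₀ (norm_nonneg _) hB).1 this
    refine (norm_add_le_of_le (h_piece k) (h_piece (k + 1))).trans (le_trans ?_ hnB)
    nlinarith
  | succ i hi ih =>
    have h_gap (d : ℤ) (hd : d = 2 ∨ d = 3) (k : ℤ) := h i d
      (mem_dyadicGaps_iff.2 (Or.inr ⟨⟨hi, hin⟩, hd⟩)) k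
    have h_adjacent (k : ℤ) := ih (Nat.le_of_succ_le hin) k
    have h_step : (1 + 2 / n) ^ i * (n * B) + 2 * B ≤ (1 + 2 / n) ^ (i + 1) * (n * B) := by
      have : 2 * B ≤ 2 / n * ((1 + 2 / n) ^ i * (n * B)) := by
        calc 2 * B = 2 / n * (n * B) := by field_simp
          _ ≤ _ := mul_le_mul_of_nonneg_left hnB (by positivity)
      rw [pow_succ']
      linarith
    refine le_trans ?_ h_step
    rw [sum_dyadicPart_succ, sum_dyadicPart_succ, mul_add, mul_one, add_assoc (2 * k) 2 1]
    have h_mid := h_adjacent (2 * k + 1)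
    have h_last := h_adjacent (2 * k + 2)
    have h_broad := h_gap 2 (Or.inl rfl) (2 * k + 1)
    rw [add_assoc] at h_mid h_last h_broad
    exact norm_add_four_le hB (h_adjacent (2 * k)) h_mid h_last
      (h_gap 2 (Or.inl rfl) (2 * k)) (h_gap 3 (Or.inr rfl) (2 * k)) h_broad

lemma norm_sum_le_of_dyadicGaps (hB : 0 ≤ B) (hn : 2 ≤ n) (hS : ∀ m ∈ S, -2 ^ n ≤ m ∧ m < 2 ^ n)
    (h : ∀ i d, (i, d) ∈ dyadicGaps n → ∀ k,
      ‖∑ m ∈ dyadicPart S i k, a m‖ * ‖∑ m ∈ dyadicPart S i (k + d), a m‖ ≤ B ^ 2) :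
    ‖∑ m ∈ S, a m‖ ≤ Real.exp 2 * n * B := by
  rw [sum_eq_sum_dyadicPart_neg_one_add a hS, mul_assoc]
  refine (norm_sum_dyadicPart_add_le hB hn h hn le_rfl (-1)).trans ?_
  gcongr
  have h_neg : (-2 : ℝ) ≤ n := by linarith [n.cast_nonneg (α := ℝ)]
  simpa [neg_div] using Real.one_sub_div_pow_le_exp_neg h_neg

lemma enorm_sum_le_of_dyadicGaps {B : ℝ≥0∞} (hn : 2 ≤ n)
    (hS : ∀ m ∈ S, -2 ^ n ≤ m ∧ m < 2 ^ n)
    (h : ∀ i d, (i, d) ∈ dyadicGaps n → ∀ k,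
      ‖∑ m ∈ dyadicPart S i k, a m‖ₑ * ‖∑ m ∈ dyadicPart S i (k + d), a m‖ₑ ≤ B ^ 2) :
    ‖∑ m ∈ S, a m‖ₑ ≤ ENNReal.ofReal (Real.exp 2 * n) * B := by
  induction B using ENNReal.recTopCoe with
  | top =>
    have : 0 < Real.exp 2 * n := by positivity
    simp [ENNReal.mul_top, this]
  | coe B =>
    rw [← ofReal_norm, ← ENNReal.ofReal_coe_nnreal, ← ENNReal.ofReal_mul (by positivity)]
    refine ENNReal.ofReal_le_ofReal (norm_sum_le_of_dyadicGaps B.2 hn hS fun i d hid k => ?_)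
    have := h i d hid k
    simp only [enorm_eq_nnnorm] at this
    exact mod_cast this

end BroadNarrow

section DyadicScales

variable {R r s l x : ℝ}

lemma exists_levels (hR : 2 ≤ R) :
    ∃ n : ℕ, 2 ≤ n ∧ ⌈√R⌉ < 2 ^ n ∧ 2 ^ n * (√R)⁻¹ ≤ 4 ∧ n ≤ 4 * Real.log R := by
  obtain ⟨n, hn, hn'⟩ := exists_nat_pow_near (Real.one_le_sqrt.2 (one_le_two.trans hR)) one_lt_two
  have hR0 : 0 < √R := Real.sqrt_pos.2 (by linarith)
  have h_ceil : ⌈√R⌉ ≤ 2 ^ (n + 1) := Int.ceil_le.2 (mod_cast hn'.le)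
  have h_log : n * Real.log 2 ≤ Real.log R / 2 := by
    rw [← Real.log_pow, ← Real.log_sqrt (by linarith)]
    exact Real.log_le_log (by positivity) hn
  have h_log_two := Real.log_le_log two_pos hR
  refine ⟨n + 2, Nat.le_add_left 2 n, h_ceil.trans_lt (by gcongr <;> lia), ?_, ?_⟩
  · rw [← div_eq_mul_inv, div_le_iff₀ hR0]
    linarith [pow_add (2 : ℝ) n 2]
  · push_cast
    nlinarith [Real.log_two_gt_d9]

lemma exists_mem_scales (hR : 1 ≤ R) (hl : (√R)⁻¹ ≤ l) (hl4 : l ≤ 4) :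
    ∃ s ∈ scales R, l ≤ 4 * s ∧ s ≤ 2 * l := by
  rcases le_total l 1 with h | h
  · have hl0 : 0 < l := (inv_pos.2 (Real.sqrt_pos.2 (by linarith))).trans_le hl
    obtain ⟨j, hj, hj'⟩ := exists_nat_pow_near_of_lt_one hl0 h one_half_pos one_half_lt_one
    rw [pow_succ] at hj
    exact ⟨(1 / 2) ^ j, ⟨⟨j, rfl⟩, hl.trans hj'⟩, by linarith, by linarith⟩
  · exact ⟨1, ⟨⟨0, by simp⟩, inv_le_one_of_one_le₀ (Real.one_le_sqrt.2 hR)⟩, by linarith,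
      by linarith⟩

lemma abs_mul_le_of_mem_blockIndices (hs : 0 < s) {m : ℤ} (hm : m ∈ blockIndices s) :
    |s * m| ≤ 1 + s := by
  have h : |(m : ℝ)| ≤ s⁻¹ + 1 :=
    le_trans (mod_cast abs_le.2 (Finset.mem_Icc.1 hm)) (Int.ceil_lt_add_one s⁻¹).le
  rw [abs_mul, abs_of_pos hs]
  calc s * |(m : ℝ)| ≤ s * (s⁻¹ + 1) := by gcongr
    _ = 1 + s := by rw [mul_add, mul_inv_cancel₀ hs.ne', mul_one]

lemma neg_mem_blockIndices {m : ℤ} : -m ∈ blockIndices s ↔ m ∈ blockIndices s := by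
  simp only [blockIndices, Finset.mem_Icc]
  lia

lemma exists_mem_blockIndices_abs_sub_le (hs : 0 < s) (hx : |x| ≤ 1 + s) :
    ∃ m ∈ blockIndices s, |s * m - x| ≤ s := by
  have h_nonneg {y : ℝ} (hy : 0 ≤ y) (hys : y ≤ 1 + s) :
      ∃ m ∈ blockIndices s, |s * m - y| ≤ s := by
    have h_le : y / s ≤ s⁻¹ + 1 := by
      rw [div_le_iff₀ hs, add_mul, inv_mul_cancel₀ hs.ne']
      linarith
    have h_ceil : ⌈y / s⌉ ≤ ⌈s⁻¹⌉ + 1 := (Int.ceil_mono h_le).trans_eq (Int.ceil_add_one _)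
    have h_pos : 0 < ⌈s⁻¹⌉ := Int.ceil_pos.2 (inv_pos.2 hs)
    have h_nonneg : 0 ≤ ⌈y / s⌉ := Int.ceil_nonneg (div_nonneg hy hs.le)
    refine ⟨⌈y / s⌉ - 1, Finset.mem_Icc.2 ⟨by lia, by lia⟩, ?_⟩
    rw [← mul_div_cancel₀ y hs.ne', ← mul_sub, abs_mul, abs_of_pos hs, mul_div_cancel₀ _ hs.ne']
    refine mul_le_of_le_one_right hs.le (abs_le.2 ?_)
    push_cast
    constructor <;> linarith [Int.le_ceil (y / s), Int.ceil_lt_add_one (y / s)]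
  rcases le_total 0 x with h | h
  · exact h_nonneg h ((le_abs_self x).trans hx)
  · obtain ⟨m, hm, hmx⟩ := h_nonneg (neg_nonneg.2 h) ((neg_le_abs x).trans hx)
    refine ⟨-m, neg_mem_blockIndices.2 hm, ?_⟩
    rwa [← abs_neg, Int.cast_neg, mul_neg, neg_sub, sub_neg_eq_add, add_comm, ← sub_neg_eq_add]

variable {S : Finset ℤ} {i n : ℕ} {k d : ℤ}

lemma transversePair_dyadicPart (hr : 0 < r) (hrs : r ≤ s) (hi : 2 ≤ i) (hs : 2 ^ i * r ≤ 4 * s)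
    (hs' : s ≤ 2 * (2 ^ i * r)) (hd0 : 0 ≤ d) (hd3 : d ≤ 3) (hd : i = 2 ∨ 2 ≤ d) {c : ℝ} {m₁ : ℤ}
    (hm₁ : m₁ ∈ dyadicPart S i k) (hc : |r * m₁ - c| ≤ s) :
    TransversePair r s c (dyadicPart S i k) (dyadicPart S i (k + d)) := by
  have h_near {e : ℤ} (he0 : 0 ≤ e) (he3 : e ≤ 3) (m : ℤ) (hm : m ∈ dyadicPart S i (k + e)) :
      |r * m - c| ≤ 20 * s := by
    obtain ⟨-, h, h'⟩ := mem_dyadicPart_iff.1 hm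
    obtain ⟨-, h₁, h₁'⟩ := mem_dyadicPart_iff.1 hm₁
    have h_sub : |m - m₁| ≤ 4 * 2 ^ i := by
      have : (0 : ℤ) < 2 ^ i := by positivity
      rw [abs_le]
      constructor <;> nlinarith
    calc |r * m - c| ≤ |r * m - r * m₁| + |r * m₁ - c| := abs_sub_le _ _ _
      _ = r * |(m : ℝ) - m₁| + |r * m₁ - c| := by rw [← mul_sub, abs_mul, abs_of_pos hr]
      _ ≤ r * (4 * 2 ^ i) + s := by gcongr; exact mod_cast h_sub
      _ ≤ 20 * s := by linarith
  refine ⟨hr, hrs, fun m hm => h_near le_rfl (by norm_num) m (by rwa [add_zero]),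
    h_near hd0 hd3, ?_⟩
  refine hd.imp (fun hi2 => ?_) fun hd2 m hm m' hm' => ?_
  · rw [hi2] at hs'
    linarith
  · obtain ⟨-, -, h⟩ := mem_dyadicPart_iff.1 hm
    obtain ⟨-, h', -⟩ := mem_dyadicPart_iff.1 hm'
    have h_sub : (2 : ℝ) ^ i + 1 ≤ m' - m := by
      have : (0 : ℤ) < 2 ^ i := by positivity
      exact mod_cast (by nlinarith : (2 : ℤ) ^ i + 1 ≤ m' - m)
    have h4 : (4 : ℝ) ≤ 2 ^ i :=
      le_trans (by norm_num) (pow_le_pow_right₀ one_le_two hi)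
    calc 3 * r + s / 4 ≤ r * (2 ^ i + 1) := by nlinarith
      _ ≤ r * (m' - m) := by gcongr

lemma exists_transversePair_dyadicPart (hR : 1 ≤ R) (hn : 2 ≤ n) (hnR : 2 ^ n * (√R)⁻¹ ≤ 4)
    (hid : (i, d) ∈ dyadicGaps n)
    (hne : (dyadicPart (blockIndices (√R)⁻¹) i k).Nonempty) :
    ∃ s ∈ scales R, ∃ m ∈ blockIndices s, TransversePair (√R)⁻¹ s (s * m)
      (dyadicPart (blockIndices (√R)⁻¹) i k) (dyadicPart (blockIndices (√R)⁻¹) i (k + d)) := by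
  obtain ⟨m₁, hm₁⟩ := hne
  have hr : 0 < (√R)⁻¹ := inv_pos.2 (Real.sqrt_pos.2 (by linarith))
  rw [mem_dyadicGaps_iff] at hid
  have hi : 2 ≤ i := by lia
  have hl : (√R)⁻¹ ≤ 2 ^ i * (√R)⁻¹ := le_mul_of_one_le_left hr.le (one_le_pow₀ one_le_two)
  have hl4 : 2 ^ i * (√R)⁻¹ ≤ 4 := le_trans (by gcongr <;> [norm_num; lia]) hnR
  obtain ⟨s, hs, hls, hsl⟩ := exists_mem_scales hR hl hl4
  have hx : |(√R)⁻¹ * m₁| ≤ 1 + s :=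
    (abs_mul_le_of_mem_blockIndices hr (dyadicPart_subset hm₁)).trans (by linarith [hs.2])
  obtain ⟨m, hm, hmx⟩ := exists_mem_blockIndices_abs_sub_le (hr.trans_le hs.2) hx
  exact ⟨s, hs, m, hm, transversePair_dyadicPart hr hs.2 hi hls hsl (by lia) (by lia) (by lia) hm₁
    (by rwa [abs_sub_comm])⟩

end DyadicScales

section SumOverDyadicParts

variable {S : Finset ℤ} {n : ℕ} {p q : ℝ}

lemma sum_rpow_le_rpow_sum {ι : Type*} (K : Finset ι) (x : ι → ℝ≥0∞) (hq : 1 ≤ q) :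
    ∑ k ∈ K, x k ^ q ≤ (∑ k ∈ K, x k) ^ q := by
  induction K using Finset.cons_induction with
  | empty => simp
  | cons k K hk ih =>
    rw [Finset.sum_cons, Finset.sum_cons]
    exact (add_le_add_right ih _).trans (ENNReal.add_rpow_le_rpow_add _ _ hq)

lemma sum_sum_dyadicPart_le (S K : Finset ℤ) (i : ℕ) (d : ℤ) (x : ℤ → ℝ≥0∞) :
    ∑ k ∈ K, ∑ m ∈ dyadicPart S i (k + d), x m ≤ ∑ m ∈ S, x m := by
  simp only [dyadicPart, ← sub_eq_iff_eq_add, Finset.sum_fiberwise_eq_sum_filter]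
  exact Finset.sum_le_sum_of_subset (Finset.filter_subset _ _)

lemma sum_rpow_sum_dyadicPart_union_le (S K : Finset ℤ) (i : ℕ) (d : ℤ) (x : ℤ → ℝ≥0∞)
    (hq : 1 ≤ q) :
    ∑ k ∈ K, (∑ m ∈ dyadicPart S i k ∪ dyadicPart S i (k + d), x m) ^ q ≤
      2 ^ q * (∑ m ∈ S, x m) ^ q := by
  rw [← ENNReal.mul_rpow_of_nonneg _ _ (by linarith)]
  refine (sum_rpow_le_rpow_sum K _ hq).trans ?_
  gcongr
  calc ∑ k ∈ K, ∑ m ∈ dyadicPart S i k ∪ dyadicPart S i (k + d), x m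
      ≤ ∑ k ∈ K, (∑ m ∈ dyadicPart S i (k + 0), x m + ∑ m ∈ dyadicPart S i (k + d), x m) := by
        gcongr with k
        rw [add_zero, ← Finset.sum_union_inter]
        exact le_self_add
    _ ≤ 2 * ∑ m ∈ S, x m := by
        rw [Finset.sum_add_distrib, two_mul]
        exact add_le_add (sum_sum_dyadicPart_le S K i 0 x) (sum_sum_dyadicPart_le S K i d x)

lemma enorm_sum_rpow_le {E : Type*} [NormedAddCommGroup E] (hp : 0 < p) (hn : 2 ≤ n)
    (hS : ∀ m ∈ S, -2 ^ n ≤ m ∧ m < 2 ^ n) (a : ℤ → E) :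
    ‖∑ m ∈ S, a m‖ₑ ^ p ≤ ENNReal.ofReal (Real.exp 2 * n) ^ p *
      ∑ g ∈ dyadicGaps n, ∑ k ∈ S.image (· / 2 ^ g.1),
        (‖∑ m ∈ dyadicPart S g.1 k, a m‖ₑ * ‖∑ m ∈ dyadicPart S g.1 (k + g.2), a m‖ₑ) ^
          (p / 2) := by
  let P (g : ℕ × ℤ) (k : ℤ) : ℝ≥0∞ :=
    (‖∑ m ∈ dyadicPart S g.1 k, a m‖ₑ * ‖∑ m ∈ dyadicPart S g.1 (k + g.2), a m‖ₑ) ^ (p / 2)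
  let Q (g : ℕ × ℤ) : ℝ≥0∞ := ∑ k ∈ S.image (· / 2 ^ g.1), P g k
  set T := ∑ g ∈ dyadicGaps n, Q g
  have h_term (i : ℕ) (d : ℤ) (hid : (i, d) ∈ dyadicGaps n) (k : ℤ) :
      ‖∑ m ∈ dyadicPart S i k, a m‖ₑ * ‖∑ m ∈ dyadicPart S i (k + d), a m‖ₑ ≤
        (T ^ p⁻¹) ^ 2 := by
    by_cases hk : k ∈ S.image (· / 2 ^ i)
    · have hPQ : P (i, d) k ≤ Q (i, d) := Finset.single_le_sum (fun _ _ => zero_le) hk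
      have hQT : Q (i, d) ≤ T := Finset.single_le_sum (fun _ _ => zero_le) hid
      rw [← ENNReal.rpow_natCast, ← ENNReal.rpow_mul, Nat.cast_two,
        show p⁻¹ * 2 = (p / 2)⁻¹ by rw [inv_div, inv_mul_eq_div],
        ENNReal.le_rpow_inv_iff (by positivity)]
      exact hPQ.trans hQT
    · have h_empty : dyadicPart S i k = ∅ :=
        Finset.filter_eq_empty_iff.2 fun m hm h => hk (Finset.mem_image.2 ⟨m, hm, h⟩)
      simp [h_empty]
  calc ‖∑ m ∈ S, a m‖ₑ ^ p ≤ (ENNReal.ofReal (Real.exp 2 * n) * T ^ p⁻¹) ^ p := by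
        gcongr
        exact enorm_sum_le_of_dyadicGaps hn hS h_term
    _ = _ := by rw [ENNReal.mul_rpow_of_nonneg _ _ hp.le, ENNReal.rpow_inv_rpow hp.ne']

variable {α : Type*} [MeasurableSpace α] {μ : Measure α}

lemma sum_lintegral_rpow_sum_dyadicPart_union_le {x : ℤ → α → ℝ≥0∞}
    (hx : ∀ m ∈ S, AEMeasurable (x m) μ) (K : Finset ℤ) (i : ℕ) (d : ℤ) (hq : 1 ≤ q) :
    ∑ k ∈ K, ∫⁻ y, (∑ m ∈ dyadicPart S i k ∪ dyadicPart S i (k + d), x m y) ^ q ∂μ ≤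
      2 ^ q * ∫⁻ y, (∑ m ∈ S, x m y) ^ q ∂μ := by
  have h_meas (k : ℤ) : AEMeasurable (fun y =>
      (∑ m ∈ dyadicPart S i k ∪ dyadicPart S i (k + d), x m y) ^ q) μ :=
    (Finset.aemeasurable_fun_sum _ fun m hm => hx m <|
      Finset.union_subset dyadicPart_subset dyadicPart_subset hm).pow_const _
  rw [← lintegral_finsetSum' _ fun k _ => h_meas k, ← lintegral_const_mul' _ _
    (ENNReal.rpow_ne_top_of_nonneg (by linarith) ENNReal.ofNat_ne_top)]
  exact lintegral_mono fun y => sum_rpow_sum_dyadicPart_union_le S K i d _ hq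

lemma lintegral_enorm_sum_rpow_le {f : ℤ → α → ℂ} (hf : ∀ m ∈ S, AEMeasurable (f m) μ)
    (hp : 0 < p) (hn : 2 ≤ n) (hS : ∀ m ∈ S, -2 ^ n ≤ m ∧ m < 2 ^ n) :
    ∫⁻ y, ‖∑ m ∈ S, f m y‖ₑ ^ p ∂μ ≤ ENNReal.ofReal (Real.exp 2 * n) ^ p *
      ∑ g ∈ dyadicGaps n, ∑ k ∈ S.image (· / 2 ^ g.1),
        ∫⁻ y, ‖(∑ m ∈ dyadicPart S g.1 k, f m y) *
          ∑ m ∈ dyadicPart S g.1 (k + g.2), f m y‖ₑ ^ (p / 2) ∂μ := by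
  have h_sum (i : ℕ) (k : ℤ) : AEMeasurable (fun y => ∑ m ∈ dyadicPart S i k, f m y) μ :=
    Finset.aemeasurable_fun_sum _ fun m hm => hf m (dyadicPart_subset hm)
  have h_meas (g : ℕ × ℤ) (k : ℤ) : AEMeasurable (fun y => ‖(∑ m ∈ dyadicPart S g.1 k, f m y) *
      ∑ m ∈ dyadicPart S g.1 (k + g.2), f m y‖ₑ ^ (p / 2)) μ :=
    ((h_sum _ _).fun_mul (h_sum _ _)).enorm.pow_const _
  simp_rw [← lintegral_finsetSum' _ fun k _ => h_meas _ k]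
  rw [← lintegral_finsetSum' _ fun g _ => Finset.aemeasurable_fun_sum _ fun k _ => h_meas g k,
    ← lintegral_const_mul' _ _ (ENNReal.rpow_ne_top_of_nonneg hp.le ENNReal.ofReal_ne_top)]
  refine lintegral_mono fun y => ?_
  simp only [enorm_mul]
  exact enorm_sum_rpow_le hp hn hS _

end SumOverDyadicParts

section WeightedEstimate

variable {p R : ℝ}

lemma enorm_squareFunction_rpow (R : ℝ) (f : ℤ → Plane → ℂ) (p : ℝ) (x : Plane) :
    ‖squareFunction R f x‖ₑ ^ p = (∑ m ∈ blockIndices (√R)⁻¹, ‖f m x‖ₑ ^ 2) ^ (p / 2) := by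
  have h_sum : ∑ m ∈ blockIndices (√R)⁻¹, ‖f m x‖ₑ ^ 2 =
      ENNReal.ofReal (∑ m ∈ blockIndices (√R)⁻¹, ‖f m x‖ ^ 2) := by
    rw [ENNReal.ofReal_sum_of_nonneg fun _ _ => sq_nonneg _]
    simp_rw [ENNReal.ofReal_pow (norm_nonneg _), ofReal_norm]
  have h_nonneg : 0 ≤ ∑ m ∈ blockIndices (√R)⁻¹, ‖f m x‖ ^ 2 :=
    Finset.sum_nonneg fun _ _ => sq_nonneg _
  rw [h_sum, squareFunction, Real.enorm_of_nonneg (Real.sqrt_nonneg _), Real.sqrt_eq_rpow,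
    ← ENNReal.ofReal_rpow_of_nonneg h_nonneg (by norm_num), ← ENNReal.rpow_mul, div_mul_eq_mul_div,
    one_mul]

lemma exists_lintegral_dyadicPart_mul_le (hp : 2 ≤ p) (hp4 : p ≤ 4) :
    ∃ C : ℝ≥0∞, C ≠ ⊤ ∧ ∀ (R : ℝ) (H : Plane → ℝ) (f : ℤ → Plane → ℂ), 1 ≤ R → AEMeasurable H →
      (∀ x, H x ∈ Set.Icc (0 : ℝ) 1) →
      (∀ m ∈ blockIndices (√R)⁻¹, HasFourierSupportIn (f m) (block (√R)⁻¹ ((√R)⁻¹ * m))) →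
      ∀ n : ℕ, 2 ≤ n → 2 ^ n * (√R)⁻¹ ≤ 4 → ∀ i d, (i, d) ∈ dyadicGaps n → ∀ k,
        ∫⁻ x, ‖(∑ m ∈ dyadicPart (blockIndices (√R)⁻¹) i k, f m x) *
            ∑ m ∈ dyadicPart (blockIndices (√R)⁻¹) i (k + d), f m x‖ₑ ^ (p / 2) *
              ENNReal.ofReal (H x) ≤
          C * ENNReal.ofReal (kappaSup p H R) ^ p *
            ∫⁻ x, (∑ m ∈ dyadicPart (blockIndices (√R)⁻¹) i k ∪
              dyadicPart (blockIndices (√R)⁻¹) i (k + d), ‖f m x‖ₑ ^ 2) ^ (p / 2) := by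
  obtain ⟨C, hC, h_pair⟩ := exists_lintegral_transversePair_le hp hp4
  refine ⟨C, hC, fun R H f hR hHm hH hf n hn hnR i d hid k => ?_⟩
  rcases (dyadicPart (blockIndices (√R)⁻¹) i k).eq_empty_or_nonempty with h_empty | h_nonempty
  · have : 0 < p / 2 := by linarith
    simp [h_empty, this]
  · obtain ⟨s, hs, m, hm, h⟩ := exists_transversePair_dyadicPart hR hn hnR hid h_nonempty
    refine h_pair _ _ _ _ _ f h (fun m hm => hf m ?_) _ hHm.ennreal_ofReal _ fun z => ?_
    · exact Finset.union_subset dyadicPart_subset dyadicPart_subset hm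
    · exact exists_bound_rpow_mul_rpow_le (by linarith)
        (rpow_lintegral_cell_le_kappaSup (by linarith) hHm hH (by linarith) hp4 hs hm z)

lemma exists_sum_lintegral_dyadicPart_mul_le (hp : 2 ≤ p) (hp4 : p ≤ 4) :
    ∃ C : ℝ≥0∞, C ≠ ⊤ ∧ ∀ (R : ℝ) (H : Plane → ℝ) (f : ℤ → Plane → ℂ), 1 ≤ R → AEMeasurable H →
      (∀ x, H x ∈ Set.Icc (0 : ℝ) 1) →
      (∀ m ∈ blockIndices (√R)⁻¹, HasFourierSupportIn (f m) (block (√R)⁻¹ ((√R)⁻¹ * m))) →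
      ∀ n : ℕ, 2 ≤ n → 2 ^ n * (√R)⁻¹ ≤ 4 → ∀ g ∈ dyadicGaps n, ∀ K : Finset ℤ,
        ∑ k ∈ K, ∫⁻ x, ‖(∑ m ∈ dyadicPart (blockIndices (√R)⁻¹) g.1 k, f m x) *
            ∑ m ∈ dyadicPart (blockIndices (√R)⁻¹) g.1 (k + g.2), f m x‖ₑ ^ (p / 2)
              ∂(volume.withDensity fun x => ENNReal.ofReal (H x)) ≤
          C * ENNReal.ofReal (kappaSup p H R) ^ p * ∫⁻ x, ‖squareFunction R f x‖ₑ ^ p := by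
  obtain ⟨C, hC, h_part⟩ := exists_lintegral_dyadicPart_mul_le hp hp4
  refine ⟨C * 2 ^ (p / 2), ENNReal.mul_ne_top hC (ENNReal.rpow_ne_top_of_nonneg (by linarith)
    ENNReal.ofNat_ne_top), fun R H f hR hHm hH hf n hn hnR g hg K => ?_⟩
  set S := blockIndices (√R)⁻¹
  set κ := ENNReal.ofReal (kappaSup p H R)
  have hfm (m : ℤ) (hm : m ∈ S) : AEMeasurable (f m) :=
    (hf m hm).1.aestronglyMeasurable.aemeasurable
  have h_sum (k : ℤ) : AEMeasurable fun x => ∑ m ∈ dyadicPart S g.1 k, f m x :=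
    Finset.aemeasurable_fun_sum _ fun m hm => hfm m (dyadicPart_subset hm)
  have h_term (k : ℤ) : ∫⁻ x, ‖(∑ m ∈ dyadicPart S g.1 k, f m x) *
      ∑ m ∈ dyadicPart S g.1 (k + g.2), f m x‖ₑ ^ (p / 2)
        ∂(volume.withDensity fun x => ENNReal.ofReal (H x)) ≤
      C * κ ^ p * ∫⁻ x, (∑ m ∈ dyadicPart S g.1 k ∪ dyadicPart S g.1 (k + g.2),
        ‖f m x‖ₑ ^ 2) ^ (p / 2) := by
    rw [lintegral_withDensity_eq_lintegral_mul₀ hHm.ennreal_ofReal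
      (((h_sum _).fun_mul (h_sum _)).enorm.pow_const _)]
    simpa only [Pi.mul_apply, mul_comm (ENNReal.ofReal (H _))] using
      h_part R H f hR hHm hH hf n hn hnR g.1 g.2 hg k
  calc _ ≤ ∑ k ∈ K, C * κ ^ p * ∫⁻ x, (∑ m ∈ dyadicPart S g.1 k ∪ dyadicPart S g.1 (k + g.2),
        ‖f m x‖ₑ ^ 2) ^ (p / 2) := Finset.sum_le_sum fun k _ => h_term k
    _ ≤ C * κ ^ p * (2 ^ (p / 2) * ∫⁻ x, (∑ m ∈ S, ‖f m x‖ₑ ^ 2) ^ (p / 2)) := by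
        rw [← Finset.mul_sum]
        gcongr
        exact sum_lintegral_rpow_sum_dyadicPart_union_le (fun m hm => (hfm m hm).enorm.pow_const 2)
          K _ _ (by linarith)
    _ = _ := by simp_rw [enorm_squareFunction_rpow]; ring

lemma exists_lintegral_enorm_sum_rpow_le (hp : 2 ≤ p) (hp4 : p ≤ 4) :
    ∃ C : ℝ≥0∞, C ≠ ⊤ ∧ ∀ (R : ℝ) (H : Plane → ℝ) (f : ℤ → Plane → ℂ), 2 ≤ R → AEMeasurable H →
      (∀ x, H x ∈ Set.Icc (0 : ℝ) 1) →
      (∀ m ∈ blockIndices (√R)⁻¹, HasFourierSupportIn (f m) (block (√R)⁻¹ ((√R)⁻¹ * m))) →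
      ∃ n : ℕ, 1 ≤ n ∧ n ≤ 4 * Real.log R ∧
        ∫⁻ x, ‖∑ m ∈ blockIndices (√R)⁻¹, f m x‖ₑ ^ p
            ∂(volume.withDensity fun x => ENNReal.ofReal (H x)) ≤
          ENNReal.ofReal (Real.exp 2 * n) ^ p * ((2 * n : ℕ) *
            (C * ENNReal.ofReal (kappaSup p H R) ^ p * ∫⁻ x, ‖squareFunction R f x‖ₑ ^ p)) := by
  obtain ⟨C, hC, h_sum⟩ := exists_sum_lintegral_dyadicPart_mul_le hp hp4
  refine ⟨C, hC, fun R H f hR hHm hH hf => ?_⟩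
  obtain ⟨n, hn, hRn, hnR, hn_log⟩ := exists_levels hR
  refine ⟨n, by lia, hn_log, ?_⟩
  have hS (m : ℤ) (hm : m ∈ blockIndices (√R)⁻¹) : -2 ^ n ≤ m ∧ m < 2 ^ n := by
    have := Finset.mem_Icc.1 hm
    rw [inv_inv] at this
    lia
  have hfm (m : ℤ) (hm : m ∈ blockIndices (√R)⁻¹) :
      AEMeasurable (f m) (volume.withDensity fun x => ENNReal.ofReal (H x)) :=
    (hf m hm).1.aestronglyMeasurable.aemeasurable.mono_ac (withDensity_absolutelyContinuous _ _)
  refine (lintegral_enorm_sum_rpow_le hfm (by linarith) hn hS).trans ?_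
  gcongr
  refine (Finset.sum_le_card_nsmul _ _ _ fun g hg =>
    h_sum R H f (by linarith) hHm hH hf n hn hnR g hg _).trans ?_
  rw [nsmul_eq_mul]
  gcongr
  exact card_dyadicGaps_le hn

lemma rpow_mul_le_ofReal_log_rpow {n : ℕ} (hn : 1 ≤ n) (hn_log : n ≤ 4 * Real.log R)
    (hp : 1 ≤ p) :
    ENNReal.ofReal (Real.exp 2 * n) ^ p * ((2 * n : ℕ) : ℝ≥0∞) ≤
      ENNReal.ofReal (32 * Real.exp 2 * Real.log R ^ 2) ^ p := by
  have h_le_rpow : ((2 * n : ℕ) : ℝ≥0∞) ≤ ((2 * n : ℕ) : ℝ≥0∞) ^ p :=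
    ENNReal.le_rpow_self_of_one_le (mod_cast by lia) hp
  calc _ ≤ ENNReal.ofReal (Real.exp 2 * n) ^ p * ((2 * n : ℕ) : ℝ≥0∞) ^ p := by gcongr
    _ = ENNReal.ofReal (2 * Real.exp 2 * (n : ℝ) ^ 2) ^ p := by
        rw [← ENNReal.mul_rpow_of_nonneg _ _ (by linarith), ← ENNReal.ofReal_natCast,
          ← ENNReal.ofReal_mul (by positivity)]
        push_cast
        ring_nf
    _ ≤ _ := by
        gcongr ENNReal.ofReal ?_ ^ p
        calc 2 * Real.exp 2 * (n : ℝ) ^ 2 ≤ 2 * Real.exp 2 * (4 * Real.log R) ^ 2 := by gcongr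
          _ = _ := by ring

lemma eLpNorm_ofReal_le_mul {α β E F : Type*} [MeasurableSpace α] [MeasurableSpace β]
    [NormedAddCommGroup E] [NormedAddCommGroup F] {μ : Measure α} {ν : Measure β} {u : α → E}
    {v : β → F} {K : ℝ≥0∞} (hp : 0 < p) (h : ∫⁻ x, ‖u x‖ₑ ^ p ∂μ ≤ K ^ p * ∫⁻ x, ‖v x‖ₑ ^ p ∂ν) :
    eLpNorm u (ENNReal.ofReal p) μ ≤ K * eLpNorm v (ENNReal.ofReal p) ν := by
  rw [eLpNorm_eq_lintegral_rpow_enorm_toReal (by simpa using hp) ENNReal.ofReal_ne_top,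
    eLpNorm_eq_lintegral_rpow_enorm_toReal (by simpa using hp) ENNReal.ofReal_ne_top,
    ENNReal.toReal_ofReal hp.le]
  calc _ ≤ (K ^ p * ∫⁻ x, ‖v x‖ₑ ^ p ∂ν) ^ (1 / p) := by gcongr
    _ = _ := by
        rw [ENNReal.mul_rpow_of_nonneg _ _ (by positivity), ← ENNReal.rpow_mul,
          mul_one_div_cancel hp.ne', ENNReal.rpow_one]

end WeightedEstimate

end WeightedSquare

open WeightedSquare in
theorem mainTheorem2_general :
    ∃ A : ℕ, ∀ p : ℝ, 2 ≤ p → p ≤ 4 → ∃ C : ℝ, 0 < C ∧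
      ∀ R : ℝ, 2 ≤ R →
      ∀ H : Plane → ℝ, AEMeasurable H volume → (∀ x, H x ∈ Set.Icc (0 : ℝ) 1) →
      ∀ (f : Plane → ℂ) (fθ : ℤ → Plane → ℂ), IsBlockDecomposition R f fθ →
        eLpNorm f (ENNReal.ofReal p) (volume.withDensity fun x => ENNReal.ofReal (H x)) ≤
          ENNReal.ofReal (C * Real.log R ^ A * kappaSup p H R) *
            eLpNorm (squareFunction R fθ) (ENNReal.ofReal p) volume := by
  refine ⟨2, fun p hp hp4 => ?_⟩
  have hp0 : 0 < p := by linarith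
  obtain ⟨C, hC, h_sum⟩ := exists_lintegral_enorm_sum_rpow_le hp hp4
  have hC' : C ^ p⁻¹ ≠ ⊤ := ENNReal.rpow_ne_top_of_nonneg (by positivity) hC
  set D := (C ^ p⁻¹).toReal + 1
  have hCD : C ≤ ENNReal.ofReal D ^ p := by
    rw [← ENNReal.rpow_inv_le_iff hp0, ENNReal.le_ofReal_iff_toReal_le hC' (by positivity)]
    exact le_add_of_nonneg_right zero_le_one
  refine ⟨32 * Real.exp 2 * D, by positivity, fun R hR H hHm hH f fθ ⟨hfθ, hf⟩ => ?_⟩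
  obtain ⟨n, hn, hn_log, hn_sum⟩ := h_sum R H fθ hR hHm hH hfθ
  rw [eLpNorm_congr_ae (withDensity_absolutelyContinuous _ _ hf)]
  refine eLpNorm_ofReal_le_mul hp0 (hn_sum.trans ?_)
  rw [← mul_assoc, ← mul_assoc]
  gcongr
  calc _ ≤ ENNReal.ofReal (32 * Real.exp 2 * Real.log R ^ 2) ^ p *
        (ENNReal.ofReal D ^ p * ENNReal.ofReal (kappaSup p H R) ^ p) := by
        gcongr
        exact rpow_mul_le_ofReal_log_rpow hn hn_log (by linarith)
    _ = _ := by
        rw [← ENNReal.mul_rpow_of_nonneg _ _ hp0.le, ← ENNReal.mul_rpow_of_nonneg _ _ hp0.le,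
          ← ENNReal.ofReal_mul (by positivity), ← ENNReal.ofReal_mul (by positivity)]
        ring_nf

theorem mainTheorem2 :
    ∃ A : ℕ, ∀ p : ℝ, 2 ≤ p → p ≤ 4 → ∃ C : ℝ, 0 < C ∧
      ∀ R : ℝ, 2 ≤ R →
      ∀ H : WeightedSquare.Plane → ℝ, AEMeasurable H volume → (∀ x, H x ∈ Set.Icc (0 : ℝ) 1) →
      ∀ f : WeightedSquare.Plane → ℂ,
        WeightedSquare.HasFourierSupportIn f (WeightedSquare.parabolaNhd R⁻¹) →
      ∀ fθ : ℤ → WeightedSquare.Plane → ℂ, WeightedSquare.IsBlockDecomposition R f fθ →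
        eLpNorm f (ENNReal.ofReal p) (volume.withDensity fun x => ENNReal.ofReal (H x)) ≤
          ENNReal.ofReal
              (C * Real.log R ^ A * (WeightedSquare.kappaSup p H R + (R ^ 100)⁻¹)) *
            eLpNorm (WeightedSquare.squareFunction R fθ) (ENNReal.ofReal p) volume := by
  obtain ⟨A, h⟩ := mainTheorem2_general
  refine ⟨A, fun p hp hp4 => ?_⟩
  obtain ⟨C, hC, h⟩ := h p hp hp4
  refine ⟨C, hC, fun R hR H hHm hH f _ fθ hf => (h R hR H hHm hH f fθ hf).trans ?_⟩
  have : 0 ≤ Real.log R := Real.log_nonneg (by linarith)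
  gcongr
  exact le_add_of_nonneg_right (by positivity)
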